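/- Let $X$ be a proper geodesic Gromov hyperbolic metric space with base point $\mathfrak o$; write $\|x\|=d(\mathfrak o,x)$. **Rays.** For $\mathsf q=(q,Q)\in[1,\infty)\times[0,\infty)$, a $\mathsf q$-ray is a map $\alpha:[0,\infty)\to X$ with $\alpha(0)=\mathfrak o$ and $\frac{|s-t|}{q}-Q\le d(\alpha(s),\alpha(t))\le q|s-t|$ for all $s,t$; a quasi-geodesic ray is a $\mathsf q$-ray for some $\mathsf q$. Let $\alpha|_r$ be the restriction of $\alpha$ to $[0,t_r]$, where $t_r$ is the first time with $\|\alpha(t_r)\|\ge r$. A ray $\alpha$ can be $\mathsf q$-redirected to $\beta$ at radius $r$ if there is a $\mathsf q$-ray $\gamma$ with $\gamma|_r=\alpha|_r$ that eventually coincides with $\beta$ up to a shift of time. Write $\alpha\preceq\beta$ if for some $\mathsf q$ this is possible at every radius $r>0$. This is a preorder; let $P(X)$ be the partially ordered set of classes of quasi-geodesic rays under the equivalence relation $\alpha\simeq\beta\iff\alpha\preceq\beta\preceq\alpha$. **Bordification.** Choose constants $\mathsf q_0$, for every $a\in P(X)$ a $\mathsf q_0$-ray $\alpha_0^a\in a$,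 and a function $f_a:[1,\infty)\times[0,\infty)\to[1,\infty)\times[0,\infty)$ such that, whenever $b\preceq a$, every $\mathsf q$-ray in $b$ can be $f_a(\mathsf q)$-redirected to $\alpha_0^a$ at every radius $r>0$. Put $F_a(q,Q)=\max\{f_a(q,Q)+(1,1),(1,q+Q)\}$ (componentwise). For $r>0$ let $\mathcal U(a,r)\subset X\cup P(X)$ be the set of those $b$ such that, for every $\mathsf q$, each $\mathsf q$-ray belonging to $b$ (if $b\in P(X)$), respectively passing through $b$ (if $b\in X$), can be $F_a(\mathsf q)$-redirected to $\alpha_0^a$ at radius $r$. Let $\mathcal B(a)$ be the family of sets containing some $\mathcal U(a,r)$, $r>0$, if $a\in P(X)$, and of sets containing some ball $B(a,r)$, $r>0$, if $a\in X$. Then $X\cup\partial X$ is the set $X\cup P(X)$, where a set is open if it belongs to $\mathcal B(a)$ for each of its points $a$. **Statement.** Assume that there are constants $\mathsf q$ such that every point of $X$ lies on a $\mathsf q$-ray (no dead ends), and that the Gromov boundary of $X$ has at least two points. Then choices $\mathsf q_0,\alpha_0^a,f_a$ as above exist, and for every such choice: 1. for every $a\in X\cup P(X)$, $\mathcal B(a)$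 is exactly the set of neighbourhoods of $a$ in $X\cup\partial X$; 2. $X\cup\partial X$ is homeomorphic to the Gromov compactification of $X$, by a homeomorphism that is the identity on $X$ and sends the class of a quasi-geodesic ray $\alpha$ to the point of the Gromov boundary represented by the sequence $(\alpha(n))_{n\in\mathbb N}$. -/

import Mathlib

open Set Filter Topology
open scoped NNReal

namespace QuasiRedirecting

/-! ### Quasi-geodesic rays -/

/-- A pair of constants `(q, Q) ∈ [1, ∞) × [0, ∞)`. -/
structure QConst where
  q : ℝ
  Q : ℝ
  one_le : 1 ≤ q
  nonneg : 0 ≤ Q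

section Rays

variable {X : Type*} [MetricSpace X]

/-- `α : [0, ∞) → X` is a `c`-ray: a `(q, Q)`-quasi-geodesic ray starting at the base point `o`.
The upper bound makes `α` `q`-Lipschitz, hence also `(2q + 2Q)`-Lipschitz and continuous. -/
def IsRay (o : X) (c : QConst) (α : ℝ≥0 → X) : Prop :=
  α 0 = o ∧ ∀ s t : ℝ≥0,
    dist s t / c.q - c.Q ≤ dist (α s) (α t) ∧ dist (α s) (α t) ≤ c.q * dist s t

/-- The first time at which `α` meets the complement of the open ball of radius `r` around `o`. -/
noncomputable def hitTime (o : X) (r : ℝ) (α : ℝ≥0 → X) : ℝ≥0 :=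
  sInf {t : ℝ≥0 | r ≤ dist o (α t)}

/-- `γ|_r = α|_r`: the restrictions up to the first exit from the open ball of radius `r` agree. -/
def AgreeUpTo (o : X) (r : ℝ) (γ α : ℝ≥0 → X) : Prop :=
  hitTime o r γ = hitTime o r α ∧ ∀ t : ℝ≥0, t ≤ hitTime o r α → γ t = α t

/-- `γ` and `β` eventually coincide, up to a shift of time. -/
def EventuallyCoincide (γ β : ℝ≥0 → X) : Prop :=
  ∃ s u : ℝ≥0, ∀ t : ℝ≥0, γ (s + t) = β (u + t)

/-- `α` can be `c`-redirected to `β` at radius `r`. -/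
def RedirectsAt (o : X) (c : QConst) (r : ℝ) (α β : ℝ≥0 → X) : Prop :=
  ∃ γ : ℝ≥0 → X, IsRay o c γ ∧ AgreeUpTo o r γ α ∧ EventuallyCoincide γ β

/-- The quasi-geodesic rays starting at `o` (with arbitrary constants). -/
def QRay (o : X) : Type _ := {α : ℝ≥0 → X // ∃ c : QConst, IsRay o c α}

namespace IsRay

variable {o : X} {c c' : QConst} {α : ℝ≥0 → X}

lemma mono (h : IsRay o c α) (hq : c.q ≤ c'.q) (hQ : c.Q ≤ c'.Q) : IsRay o c' α := by
  refine ⟨h.1, fun s t => ⟨?_, ?_⟩⟩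
  · have h1 := (h.2 s t).1
    have h2 : dist s t / c'.q ≤ dist s t / c.q :=
      div_le_div_of_nonneg_left dist_nonneg (by linarith [c.one_le]) hq
    linarith
  · exact (h.2 s t).2.trans (mul_le_mul_of_nonneg_right hq dist_nonneg)

lemma continuous (h : IsRay o c α) : Continuous α := by
  have : LipschitzWith (Real.toNNReal c.q) α := by
    refine LipschitzWith.of_dist_le_mul fun s t => ?_
    rw [Real.coe_toNNReal _ (by linarith [c.one_le])]
    exact (h.2 s t).2
  exact this.continuous

lemma norm_le (h : IsRay o c α) (t : ℝ≥0) : dist o (α t) ≤ c.q * t := by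
  have := (h.2 0 t).2
  rw [h.1, dist_comm (0 : ℝ≥0) t, NNReal.dist_eq] at this
  simpa [abs_of_nonneg t.2] using this

lemma le_norm (h : IsRay o c α) (t : ℝ≥0) : (t : ℝ) / c.q - c.Q ≤ dist o (α t) := by
  have := (h.2 0 t).1
  rw [h.1, dist_comm (0 : ℝ≥0) t, NNReal.dist_eq] at this
  simpa [abs_of_nonneg t.2] using this

lemma exists_le_norm (h : IsRay o c α) (r : ℝ) : {t : ℝ≥0 | r ≤ dist o (α t)}.Nonempty := by
  have hq : 0 < c.q := by linarith [c.one_le]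
  refine ⟨Real.toNNReal (c.q * (r + c.Q)), ?_⟩
  have h1 := h.le_norm (Real.toNNReal (c.q * (r + c.Q)))
  have h2 : c.q * (r + c.Q) ≤ (Real.toNNReal (c.q * (r + c.Q)) : ℝ) := Real.le_coe_toNNReal _
  have h3 : r + c.Q ≤ (Real.toNNReal (c.q * (r + c.Q)) : ℝ) / c.q := by
    rw [le_div_iff₀ hq]; linarith
  change r ≤ dist o (α (Real.toNNReal (c.q * (r + c.Q))))
  linarith

lemma le_norm_hitTime (h : IsRay o c α) (r : ℝ) : r ≤ dist o (α (hitTime o r α)) := by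
  have hc : IsClosed {t : ℝ≥0 | r ≤ dist o (α t)} :=
    isClosed_le continuous_const (continuous_const.dist h.continuous)
  exact hc.csInf_mem (h.exists_le_norm r) (OrderBot.bddBelow _)

lemma hitTime_mono (h : IsRay o c α) {r r' : ℝ} (hr : r ≤ r') :
    hitTime o r α ≤ hitTime o r' α :=
  csInf_le_csInf (OrderBot.bddBelow _) (h.exists_le_norm r') fun _ ht => hr.trans ht

lemma le_hitTime (h : IsRay o c α) {r : ℝ} {T : ℝ≥0} (hr : c.q * T < r) :
    T ≤ hitTime o r α := by
  refine le_csInf (h.exists_le_norm r) fun t ht => ?_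
  by_contra hlt
  have h1 : (t : ℝ) ≤ T := by exact_mod_cast (not_le.1 hlt).le
  have h2 := h.norm_le t
  have h3 : c.q * t ≤ c.q * T := mul_le_mul_of_nonneg_left h1 (by linarith [c.one_le])
  have h4 : r ≤ dist o (α t) := ht
  linarith

end IsRay

lemma hitTime_le {o : X} {r : ℝ} {α : ℝ≥0 → X} {t : ℝ≥0} (h : r ≤ dist o (α t)) :
    hitTime o r α ≤ t :=
  csInf_le (OrderBot.bddBelow _) h

/-- Agreement up to the exit time of one of two rays is enough. -/
lemma AgreeUpTo.of_eq {o : X} {c c' : QConst} {r : ℝ} {γ α : ℝ≥0 → X} (hγ : IsRay o c γ)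
    (hα : IsRay o c' α) (h : ∀ t : ℝ≥0, t ≤ hitTime o r α → γ t = α t) : AgreeUpTo o r γ α := by
  refine ⟨le_antisymm (hitTime_le ?_) ?_, h⟩
  · rw [h _ le_rfl]; exact hα.le_norm_hitTime r
  · by_contra hlt
    have h1 := hγ.le_norm_hitTime r
    rw [h _ (not_le.1 hlt).le] at h1
    exact hlt (hitTime_le h1)

lemma AgreeUpTo.mono {o : X} {c c' : QConst} {r r' : ℝ} {γ α : ℝ≥0 → X} (hγ : IsRay o c γ)
    (hα : IsRay o c' α) (hr : r ≤ r') (h : AgreeUpTo o r' γ α) : AgreeUpTo o r γ α :=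
  AgreeUpTo.of_eq hγ hα fun t ht => h.2 t (ht.trans (hα.hitTime_mono hr))

lemma RedirectsAt.mono {o : X} {c c' : QConst} {r r' : ℝ} {α β : ℝ≥0 → X} (hα : IsRay o c' α)
    (hr : r ≤ r') (h : RedirectsAt o c r' α β) : RedirectsAt o c r α β := by
  obtain ⟨γ, h1, h2, h3⟩ := h
  exact ⟨γ, h1, h2.mono h1 hα hr, h3⟩

/-! ### The redirecting preorder and the set of directions -/

/-- Redirecting with uniform constants is transitive. -/
lemma redirects_trans {o : X} {c₁ c₂ cα cβ : QConst} {α β γ : ℝ≥0 → X}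
    (hα : IsRay o cα α) (hβ : IsRay o cβ β)
    (h₁ : ∀ r : ℝ, 0 < r → RedirectsAt o c₁ r α β)
    (h₂ : ∀ r : ℝ, 0 < r → RedirectsAt o c₂ r β γ) :
    ∃ c : QConst, ∀ r : ℝ, 0 < r → RedirectsAt o c r α γ := by
  have hq1 := c₁.one_le
  have hq2 := c₂.one_le
  let c : QConst := ⟨max c₁.q c₂.q + 1, max c₁.Q c₂.Q,
    by linarith [le_max_left c₁.q c₂.q], le_max_of_le_left c₁.nonneg⟩
  have hc1 : c₁.q ≤ c.q := by
    change c₁.q ≤ max c₁.q c₂.q + 1; linarith [le_max_left c₁.q c₂.q]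
  have hc2 : c₂.q + 1 ≤ c.q := by
    change c₂.q + 1 ≤ max c₁.q c₂.q + 1; linarith [le_max_right c₁.q c₂.q]
  have hQ1 : c₁.Q ≤ c.Q := le_max_left _ _
  have hQ2 : c₂.Q ≤ c.Q := le_max_right _ _
  have hcpos : 0 < c.q := by linarith
  refine ⟨c, fun r hr => ?_⟩
  obtain ⟨ζ₁, hζ₁, ha₁, s₁, u₁, he₁⟩ := h₁ r hr
  have hgap : 0 < 1 / c₂.q - 1 / c.q := by
    have := one_div_lt_one_div_of_lt (by linarith : (0 : ℝ) < c₂.q) (by linarith : c₂.q < c.q)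
    linarith
  have hnum : 0 ≤ c₁.q * s₁ + s₁ := by
    have : (0 : ℝ) ≤ s₁ := s₁.2
    have : 0 ≤ c₁.q * (s₁ : ℝ) := mul_nonneg (by linarith) this
    linarith
  let T : ℝ≥0 := ⟨(c₁.q * s₁ + s₁) / (1 / c₂.q - 1 / c.q), div_nonneg hnum hgap.le⟩
    + hitTime o r α
  have hTα : hitTime o r α ≤ T := le_add_of_nonneg_left zero_le
  have hT : c₁.q * s₁ + s₁ ≤ (1 / c₂.q - 1 / c.q) * (T : ℝ) := by
    have h1 : (c₁.q * s₁ + s₁) / (1 / c₂.q - 1 / c.q) ≤ (T : ℝ) := by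
      change _ ≤ (c₁.q * s₁ + s₁) / (1 / c₂.q - 1 / c.q) + (hitTime o r α : ℝ)
      linarith [(hitTime o r α).2]
    rw [div_le_iff₀ hgap] at h1
    linarith
  obtain ⟨ζ₂, hζ₂, ha₂, s₂, u₂, he₂⟩ := h₂ (cβ.q * (u₁ + T : ℝ≥0) + 1) (by
    have : 0 ≤ cβ.q * ((u₁ + T : ℝ≥0) : ℝ) := mul_nonneg (by linarith [cβ.one_le]) (NNReal.coe_nonneg _)
    linarith)
  have hhit : u₁ + T ≤ hitTime o (cβ.q * (u₁ + T : ℝ≥0) + 1) β := hβ.le_hitTime (by linarith)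
  let ζ : ℝ≥0 → X := fun t => if t ≤ s₁ + T then ζ₁ t else ζ₂ (u₁ + (t - s₁))
  have hA : ∀ t, t ≤ s₁ + T → ζ t = ζ₁ t := fun t ht => if_pos ht
  have hB : ∀ v, ζ (s₁ + v) = ζ₂ (u₁ + v) := by
    intro v
    by_cases hv : s₁ + v ≤ s₁ + T
    · rw [hA _ hv, he₁, ha₂.2]
      exact (add_le_add_right (le_of_add_le_add_left hv) u₁).trans hhit
    · have : ζ (s₁ + v) = ζ₂ (u₁ + (s₁ + v - s₁)) := if_neg hv
      rw [this, add_tsub_cancel_left]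
  have hd : ∀ a b x : ℝ≥0, dist (x + a) (x + b) = dist a b := by
    intro a b x; simp [NNReal.dist_eq]
  have hB' : ∀ v w : ℝ≥0, dist v w / c.q - c.Q ≤ dist (ζ (s₁ + v)) (ζ (s₁ + w)) ∧
      dist (ζ (s₁ + v)) (ζ (s₁ + w)) ≤ c.q * dist v w := by
    intro v w
    have := (hζ₂.mono (c' := c) (by linarith) hQ2).2 (u₁ + v) (u₁ + w)
    rwa [hd, ← hB, ← hB] at this
  have hA' : ∀ v w : ℝ≥0, v ≤ s₁ + T → w ≤ s₁ + T → dist v w / c.q - c.Q ≤ dist (ζ v) (ζ w) ∧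
      dist (ζ v) (ζ w) ≤ c.q * dist v w := by
    intro v w hv hw
    rw [hA v hv, hA w hw]
    exact (hζ₁.mono hc1 hQ1).2 v w
  have key : ∀ s t : ℝ≥0, s ≤ t → dist s t / c.q - c.Q ≤ dist (ζ s) (ζ t) ∧
      dist (ζ s) (ζ t) ≤ c.q * dist s t := by
    intro s t hst
    by_cases ht : t ≤ s₁ + T
    · exact hA' s t (hst.trans ht) ht
    by_cases hs : s₁ ≤ s
    · obtain ⟨v, rfl⟩ := exists_add_of_le hs
      obtain ⟨w, rfl⟩ := exists_add_of_le (hs.trans hst)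
      rw [hd]
      exact hB' v w
    have hs' : s ≤ s₁ := (not_le.1 hs).le
    have hs'' : s ≤ s₁ + T := hs'.trans (le_add_of_nonneg_right zero_le)
    have ht' : s₁ + T ≤ t := (not_le.1 ht).le
    obtain ⟨w, rfl⟩ := exists_add_of_le ((le_add_of_nonneg_right zero_le).trans ht')
    have hTw : (T : ℝ) ≤ w := by exact_mod_cast le_of_add_le_add_left ht'
    have hsr : (s : ℝ) ≤ s₁ := by exact_mod_cast hs'
    have hs0 : (0 : ℝ) ≤ s := s.2
    have hu0 : (0 : ℝ) ≤ u₁ := u₁.2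
    have hdist : dist s (s₁ + w) = (s₁ : ℝ) + w - s := by
      rw [dist_comm, NNReal.dist_eq, NNReal.coe_add, abs_of_nonneg]
      linarith [w.2]
    rw [hdist]
    constructor
    · have h1 := hζ₂.le_norm (u₁ + w)
      have h2 := hζ₁.norm_le s
      rw [← hB, NNReal.coe_add, add_div] at h1
      rw [← hA s hs''] at h2
      have h3 := dist_triangle o (ζ s) (ζ (s₁ + w))
      have h4 : c₁.q * s ≤ c₁.q * s₁ := mul_le_mul_of_nonneg_left hsr (by linarith)
      have h5 : (0 : ℝ) ≤ u₁ / c₂.q := div_nonneg hu0 (by linarith)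
      have h6 : ((s₁ : ℝ) + w - s) / c.q ≤ s₁ + w / c.q := by
        rw [div_le_iff₀ hcpos, add_mul, div_mul_cancel₀ _ hcpos.ne']
        have : (s₁ : ℝ) * 1 ≤ s₁ * c.q := mul_le_mul_of_nonneg_left (by linarith) s₁.2
        linarith
      have h7 : (1 / c₂.q - 1 / c.q) * (T : ℝ) ≤ (1 / c₂.q - 1 / c.q) * w :=
        mul_le_mul_of_nonneg_left hTw hgap.le
      have h8 : (1 / c₂.q - 1 / c.q) * (w : ℝ) = w / c₂.q - w / c.q := by ring
      linarith
    · have h1 := (hA' s s₁ hs'' (le_add_of_nonneg_right zero_le)).2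
      have h2 := (hB' 0 w).2
      rw [add_zero] at h2
      have h3 := dist_triangle (ζ s) (ζ s₁) (ζ (s₁ + w))
      have h4 : dist s s₁ = (s₁ : ℝ) - s := by
        rw [dist_comm, NNReal.dist_eq, abs_of_nonneg]; linarith
      have h5 : dist (0 : ℝ≥0) w = (w : ℝ) := by
        rw [dist_comm, NNReal.dist_eq]; simp
      rw [h4] at h1
      rw [h5] at h2
      have h6 : c.q * ((s₁ : ℝ) + w - s) = c.q * (s₁ - s) + c.q * w := by ring
      linarith
  have hζ : IsRay o c ζ := by
    refine ⟨by rw [hA 0 zero_le, hζ₁.1], fun s t => ?_⟩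
    rcases le_total s t with h | h
    · exact key s t h
    · rw [dist_comm s t, dist_comm (ζ s)]; exact key t s h
  refine ⟨ζ, hζ, AgreeUpTo.of_eq hζ hα fun t ht => ?_, s₁ + (s₂ + u₁), u₂ + u₁ + u₁, fun t => ?_⟩
  · rw [hA t (ht.trans (hTα.trans (le_add_of_nonneg_left zero_le))), ha₁.2 t ht]
  · have e1 : s₁ + (s₂ + u₁) + t = s₁ + (s₂ + u₁ + t) := by ring
    have e2 : u₁ + (s₂ + u₁ + t) = s₂ + (u₁ + u₁ + t) := by ring
    have e3 : u₂ + u₁ + u₁ + t = u₂ + (u₁ + u₁ + t) := by ring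
    rw [e1, hB, e2, he₂, e3]

/-- `α ⪯ β`: for some constants `c`, `α` can be `c`-redirected to `β` at every radius. -/
instance (o : X) : Preorder (QRay o) where
  le α β := ∃ c : QConst, ∀ r : ℝ, 0 < r → RedirectsAt o c r α.1 β.1
  le_refl α := by
    obtain ⟨c, hc⟩ := α.2
    exact ⟨c, fun r _ => ⟨α.1, hc, ⟨rfl, fun _ _ => rfl⟩, 0, 0, fun _ => rfl⟩⟩
  le_trans α β γ h₁ h₂ := by
    obtain ⟨cα, hα⟩ := α.2
    obtain ⟨cβ, hβ⟩ := β.2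
    obtain ⟨c₁, h₁⟩ := h₁
    obtain ⟨c₂, h₂⟩ := h₂
    exact redirects_trans hα hβ h₁ h₂

/-- The partially ordered set `P(X)` of classes of quasi-geodesic rays, where `α ≃ β` means
`α ⪯ β` and `β ⪯ α`. -/
abbrev Directions (o : X) : Type _ := Antisymmetrization (QRay o) (· ≤ ·)

/-- The class of a quasi-geodesic ray. -/
def QRay.direction {o : X} (α : QRay o) : Directions o := toAntisymmetrization (· ≤ ·) α

/-! ### The bordification `X ∪ ∂X` -/

/-- No dead ends: for some constants `c`, every point of `X` lies on a `c`-ray. -/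
def NoDeadEnds (o : X) : Prop :=
  ∃ c : QConst, ∀ x : X, ∃ α : ℝ≥0 → X, IsRay o c α ∧ x ∈ range α

/-- The choices on which the topology of `X ∪ P(X)` is built: for every class `a` a central
element of `a`, the central elements having uniform constants, and a redirecting function `f a`:
if `b ⪯ a`, every `c`-ray in `b` can be `f a c`-redirected to the central element of `a`. -/
structure RedirectingData (o : X) where
  c₀ : QConst
  central : Directions o → QRay o
  central_mem : ∀ a, (central a).direction = a
  central_isRay : ∀ a, IsRay o c₀ (central a).1
  f : Directions o → QConst → QConst
  redirects : ∀ a b : Directions o, b ≤ a → ∀ (c : QConst) (β : QRay o), β.direction = b →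
    IsRay o c β.1 → ∀ r : ℝ, 0 < r → RedirectsAt o (f a c) r β.1 (central a).1

namespace RedirectingData

variable {o : X} (D : RedirectingData o)

/-- `F_a(q, Q) = max {f_a(q, Q) + (1, 1), (1, q + Q)}`. -/
noncomputable def F (a : Directions o) (c : QConst) : QConst where
  q := max ((D.f a c).q + 1) 1
  Q := max ((D.f a c).Q + 1) (c.q + c.Q)
  one_le := le_max_right _ _
  nonneg := le_max_of_le_left (by linarith [(D.f a c).nonneg])

/-- The set `X ∪ P(X)`, to be topologized by means of `D`. -/
def Bordification (_ : RedirectingData o) : Type _ := X ⊕ Directions o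

/-- A point of `X` as a point of `X ∪ P(X)`. -/
def ofPoint (x : X) : D.Bordification := Sum.inl x

/-- A direction as a point of `X ∪ P(X)`. -/
def ofDirection (a : Directions o) : D.Bordification := Sum.inr a

/-- The rays that a point of `X ∪ P(X)` stands for: those passing through it, if it is in `X`,
and those of the class, if it is a class. -/
def rays : D.Bordification → Set (QRay o)
  | Sum.inl x => {β | x ∈ range β.1}
  | Sum.inr b => {β | β.direction = b}

/-- The set `U(a, r)`. -/
def U (a : Directions o) (r : ℝ) : Set D.Bordification :=
  {b | ∀ (c : QConst) (β : QRay o), β ∈ D.rays b → IsRay o c β.1 →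
    RedirectsAt o (D.F a c) r β.1 (D.central a).1}

lemma U_anti (a : Directions o) {r r' : ℝ} (h : r ≤ r') : D.U a r' ⊆ D.U a r :=
  fun _ hb c β hβ hc => (hb c β hβ hc).mono hc h

/-- The system of neighbourhoods: at a class `a`, the sets containing some `U(a, r)`, `r > 0`; at
a point `x` of `X`, the sets containing some ball `B(x, r)`, `r > 0`. -/
def nbhd : D.Bordification → Filter D.Bordification
  | Sum.inl x =>
    { sets := {V | ∃ r : ℝ, 0 < r ∧ D.ofPoint '' Metric.ball x r ⊆ V}
      univ_sets := ⟨1, one_pos, subset_univ _⟩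
      sets_of_superset := fun ⟨r, hr, h⟩ hV => ⟨r, hr, h.trans hV⟩
      inter_sets := fun ⟨r, hr, h⟩ ⟨r', hr', h'⟩ => ⟨min r r', lt_min hr hr', subset_inter
        ((image_mono (Metric.ball_subset_ball (min_le_left _ _))).trans h)
        ((image_mono (Metric.ball_subset_ball (min_le_right _ _))).trans h')⟩ }
  | Sum.inr a =>
    { sets := {V | ∃ r : ℝ, 0 < r ∧ D.U a r ⊆ V}
      univ_sets := ⟨1, one_pos, subset_univ _⟩
      sets_of_superset := fun ⟨r, hr, h⟩ hV => ⟨r, hr, h.trans hV⟩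
      inter_sets := fun ⟨r, hr, h⟩ ⟨r', _, h'⟩ => ⟨max r r', lt_max_of_lt_left hr, subset_inter
        ((D.U_anti a (le_max_left _ _)).trans h) ((D.U_anti a (le_max_right _ _)).trans h')⟩ }

/-- The topology of `X ∪ ∂X`: a set is open if it is a neighbourhood of each of its points. -/
instance : TopologicalSpace D.Bordification where
  IsOpen V := ∀ b ∈ V, V ∈ D.nbhd b
  isOpen_univ _ _ := univ_mem
  isOpen_inter _ _ h h' b hb := inter_mem (h b hb.1) (h' b hb.2)
  isOpen_sUnion _ h b := fun ⟨V, hV, hb⟩ => mem_of_superset (h V hV b hb) (subset_sUnion_of_mem hV)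

end RedirectingData

/-! ### Gromov hyperbolicity and the Gromov compactification -/

/-- Any two points are joined by a geodesic segment. -/
def IsGeodesicSpace (X : Type*) [MetricSpace X] : Prop :=
  ∀ x y : X, ∃ γ : ℝ → X, γ 0 = x ∧ γ (dist x y) = y ∧
    ∀ s ∈ Icc 0 (dist x y), ∀ t ∈ Icc 0 (dist x y), dist (γ s) (γ t) = |s - t|

/-- The Gromov product of `x` and `y` with respect to `w`. -/
noncomputable def gromovProduct (w x y : X) : ℝ := (dist w x + dist w y - dist x y) / 2

lemma gromovProduct_comm (w x y : X) : gromovProduct w x y = gromovProduct w y x := by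
  unfold gromovProduct; rw [dist_comm x y]; ring

/-- Gromov hyperbolicity, by the four-point condition. -/
class GromovHyperbolic (X : Type*) [MetricSpace X] : Prop where
  exists_delta : ∃ δ : ℝ, ∀ w x y z : X,
    min (gromovProduct w x y) (gromovProduct w y z) - δ ≤ gromovProduct w x z

/-- The sequences converging to infinity: those with `(xᵢ | xⱼ) → ∞` as `i, j → ∞`. -/
def GromovSeq (o : X) : Type _ :=
  {x : ℕ → X // Tendsto (fun p : ℕ × ℕ => gromovProduct o (x p.1) (x p.2)) atTop atTop}

/-- Two sequences converging to infinity are equivalent if `(xᵢ | yⱼ) → ∞` as `i, j → ∞`. -/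
def gromovSetoid [GromovHyperbolic X] (o : X) : Setoid (GromovSeq o) where
  r x y := Tendsto (fun p : ℕ × ℕ => gromovProduct o (x.1 p.1) (y.1 p.2)) atTop atTop
  iseqv :=
    { refl := fun x => x.2
      symm := by
        intro x y h
        rw [tendsto_atTop] at h ⊢
        intro R
        obtain ⟨N, hN⟩ := eventually_atTop.1 (h R)
        refine eventually_atTop.2 ⟨N.swap, fun p hp => ?_⟩
        rw [gromovProduct_comm]
        exact hN p.swap ⟨hp.2, hp.1⟩
      trans := by
        intro x y z h h'
        obtain ⟨δ, hδ⟩ := GromovHyperbolic.exists_delta (X := X)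
        rw [tendsto_atTop] at h h' ⊢
        intro R
        obtain ⟨N, hN⟩ := eventually_atTop.1 (h (R + δ))
        obtain ⟨M, hM⟩ := eventually_atTop.1 (h' (R + δ))
        refine eventually_atTop.2 ⟨(N.1, M.2), fun p hp => ?_⟩
        have h1 := hN (p.1, max N.2 M.1) ⟨hp.1, le_max_left _ _⟩
        have h2 := hM (max N.2 M.1, p.2) ⟨le_max_right _ _, hp.2⟩
        have h3 := hδ o (x.1 p.1) (y.1 (max N.2 M.1)) (z.1 p.2)
        have h4 := le_min h1 h2
        linarith }

/-- The Gromov boundary. -/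
def GromovBoundary [GromovHyperbolic X] (o : X) : Type _ := Quotient (gromovSetoid o)

/-- The boundary point to which a sequence converges. -/
def GromovSeq.limit [GromovHyperbolic X] {o : X} (x : GromovSeq o) : GromovBoundary o :=
  Quotient.mk (gromovSetoid o) x

/-- The set `X ∪ ∂_G X` underlying the Gromov compactification. -/
def GromovCompactification [GromovHyperbolic X] (o : X) : Type _ := X ⊕ GromovBoundary o

namespace GromovCompactification

variable [GromovHyperbolic X] {o : X}

/-- A point of `X` as a point of the compactification. -/
def ofPoint (x : X) : GromovCompactification o := Sum.inl x

/-- A point of the Gromov boundary as a point of the compactification. -/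
def ofBoundary (ξ : GromovBoundary o) : GromovCompactification o := Sum.inr ξ

/-- The basic neighbourhood of `ξ` in the compactification: the points `y` of `X` with
`(xᵢ | y) ≥ R` eventually for some `xᵢ → ξ`, and the boundary points `η` with `(xᵢ | yⱼ) ≥ R`
eventually for some `xᵢ → ξ` and `yⱼ → η`. -/
def N (ξ : GromovBoundary o) (R : ℝ) : Set (GromovCompactification o) :=
  {p | ∃ x : GromovSeq o, x.limit = ξ ∧ match p with
    | Sum.inl y => ∀ᶠ i in atTop, R ≤ gromovProduct o (x.1 i) y
    | Sum.inr η => ∃ y : GromovSeq o, y.limit = η ∧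
        ∀ᶠ q : ℕ × ℕ in atTop, R ≤ gromovProduct o (x.1 q.1) (y.1 q.2)}

lemma N_anti (ξ : GromovBoundary o) {R R' : ℝ} (h : R ≤ R') : N ξ R' ⊆ N ξ R := by
  rintro (y | η) ⟨x, hx, hp⟩
  · exact ⟨x, hx, hp.mono fun _ hi => h.trans hi⟩
  · obtain ⟨y, hy, hp⟩ := hp
    exact ⟨x, hx, y, hy, hp.mono fun _ hi => h.trans hi⟩

/-- A set is open if with each `x` in `X` it contains a ball around `x`, and with each boundary
point `ξ` some `N ξ R`. -/
instance : TopologicalSpace (GromovCompactification o) where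
  IsOpen V := (∀ x : X, ofPoint x ∈ V → ∃ r : ℝ, 0 < r ∧ ofPoint '' Metric.ball x r ⊆ V) ∧
    ∀ ξ : GromovBoundary o, ofBoundary ξ ∈ V → ∃ R : ℝ, N ξ R ⊆ V
  isOpen_univ := ⟨fun _ _ => ⟨1, one_pos, subset_univ _⟩, fun _ _ => ⟨0, subset_univ _⟩⟩
  isOpen_inter V W hV hW := by
    refine ⟨fun x hx => ?_, fun ξ hξ => ?_⟩
    · obtain ⟨r, hr, h⟩ := hV.1 x hx.1
      obtain ⟨r', hr', h'⟩ := hW.1 x hx.2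
      exact ⟨min r r', lt_min hr hr', subset_inter
        ((image_mono (Metric.ball_subset_ball (min_le_left _ _))).trans h)
        ((image_mono (Metric.ball_subset_ball (min_le_right _ _))).trans h')⟩
    · obtain ⟨R, h⟩ := hV.2 ξ hξ.1
      obtain ⟨R', h'⟩ := hW.2 ξ hξ.2
      exact ⟨max R R', subset_inter ((N_anti ξ (le_max_left _ _)).trans h)
        ((N_anti ξ (le_max_right _ _)).trans h')⟩
  isOpen_sUnion S hS := by
    refine ⟨fun x ⟨V, hV, hx⟩ => ?_, fun ξ ⟨V, hV, hξ⟩ => ?_⟩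
    · obtain ⟨r, hr, h⟩ := (hS V hV).1 x hx
      exact ⟨r, hr, h.trans (subset_sUnion_of_mem hV)⟩
    · obtain ⟨R, h⟩ := (hS V hV).2 ξ hξ
      exact ⟨R, h.trans (subset_sUnion_of_mem hV)⟩

end GromovCompactification

end Rays

end QuasiRedirecting

namespace QuasiRedirecting

/-! ### Gromov products and the four-point condition -/

section GromovProduct

variable {X : Type*} [MetricSpace X]

/-! Write `(x|y)` for the Gromov product at `o`. Quasi-geodesic rays are stable: along a `c`-ray,
`(β s|β t) ≥ ‖β s‖ - C` for `s ≤ t`, with `C` depending only on `c`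
(`exists_norm_sub_le_gromovProduct`). So a ray that can be redirected to `α` at every radius has the
endpoint of `α`. Conversely, rays with the same endpoint can be redirected to each other through a
geodesic ray (`redirectsAt_of_asymptotic_geodesic`, `exists_redirectsAt_of_geodesic`). The preorder
is therefore equality of endpoints (`QRay.le_iff`), and `endpoint` identifies `P(X)` with the Gromov
boundary. Geodesic rays serve as central elements.

It remains to compare `U(a, r)` with the sets `N ξ R`, where `ξ` is the endpoint of `a`.

`N ξ R ⊆ U(a, r)` for large `R` (`exists_mem_U`). The difficulty is that `R` must serve all
constants `(q, Q)` at once, whereas stability depends on them. If the constants are large compared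
with `r`, one may follow the ray to radius `r`, walk back to `o` and take the geodesic ray: the
additive constant `q + Q` pays for the detour. Otherwise `(q, Q)` is bounded in terms of `r`,
stability is uniform, and a surgery at the near-minimum of a suitable function redirects the ray. A
last redirection, from the geodesic ray to the central element, stays within `F_a`.

`U(a, r) ⊆ N ξ R` for large `r` (`exists_mem_N`). A redirected ray has large Gromov product with its
target at radius `r`, and this settles classes and the points met after radius `r`. A point `x` met
earlier lies on the redirected ray itself, whence `(x|a) ≥ ‖x‖ - C`; so `‖x‖` must be large. Here a
second boundary point is needed: through a point near `o` passes a ray towards that other point,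
with controlled constants, and it cannot be redirected to `a` at a large radius
(`exists_norm_lt_of_mem_U`). -/

lemma gromovProduct_le_dist (w x y : X) : gromovProduct w x y ≤ dist w x := by
  unfold gromovProduct; linarith [dist_triangle w x y]

lemma dist_sub_dist_le_gromovProduct (w x y : X) :
    dist w x - dist x y ≤ gromovProduct w x y := by
  unfold gromovProduct; linarith [dist_triangle_right w x y]

lemma gromovProduct_self (w x : X) : gromovProduct w x x = dist w x := by
  unfold gromovProduct; rw [dist_self]; ring

lemma gromovProduct_eq_sub (o x y : X) : gromovProduct o x y = dist o x - gromovProduct x o y := by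
  unfold gromovProduct; rw [dist_comm x o]; ring

lemma gromovProduct_le_add (o x x' y : X) :
    gromovProduct o x y ≤ gromovProduct o x' y + dist x x' := by
  unfold gromovProduct
  linarith [dist_triangle_right o x x', dist_triangle x x' y, dist_triangle o x' x,
    dist_triangle_left x' y x, dist_comm x x']

/-- The four-point condition with a nonnegative constant `δ`. -/
def IsHyperbolicConst (X : Type*) [MetricSpace X] (δ : ℝ) : Prop :=
  0 ≤ δ ∧ ∀ w x y z : X,
    min (gromovProduct w x y) (gromovProduct w y z) - δ ≤ gromovProduct w x z

lemma exists_isHyperbolicConst (X : Type*) [MetricSpace X] [GromovHyperbolic X] :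
    ∃ δ : ℝ, IsHyperbolicConst X δ := by
  obtain ⟨δ, hδ⟩ := GromovHyperbolic.exists_delta (X := X)
  exact ⟨max δ 0, le_max_right _ _, fun w x y z => by linarith [hδ w x y z, le_max_left δ 0]⟩

lemma IsHyperbolicConst.le_gromovProduct {δ : ℝ} (hδ : IsHyperbolicConst X δ) {w x y z : X}
    {K : ℝ} (h : K ≤ gromovProduct w x y) (h' : K ≤ gromovProduct w y z) :
    K - δ ≤ gromovProduct w x z := by
  linarith [hδ.2 w x y z, le_min h h']

/-- A Lipschitz path that stays away from a point cannot have its ends seen far apart from it. -/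
lemma le_gromovProduct_of_path {δ : ℝ} (hδ : IsHyperbolicConst X δ) {K : ℝ} {α : ℝ≥0 → X}
    (hα : ∀ s t : ℝ≥0, dist (α s) (α t) ≤ K * dist s t) {p : X} {D : ℝ} (N : ℕ) :
    ∀ a b : ℝ≥0, a ≤ b → (∀ u ∈ Icc a b, D ≤ dist p (α u)) →
      D - K * (b - a) / 2 ^ N - N * δ ≤ gromovProduct p (α a) (α b) := by
  induction N with
  | zero =>
    intro a b hab h
    have h1 := dist_sub_dist_le_gromovProduct p (α a) (α b)
    have h2 := hα a b
    rw [dist_comm a b, NNReal.dist_eq, abs_of_nonneg (sub_nonneg.2 (by exact_mod_cast hab))] at h2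
    have h3 := h a ⟨le_rfl, hab⟩
    simp only [pow_zero, div_one, Nat.cast_zero, zero_mul]
    linarith
  -- Halving the time interval halves the length term and costs one `δ`, so a path of length `L`
  -- loses only about `δ * log L`.
  | succ N ih =>
    intro a b hab h
    have ham : a ≤ (a + b) / 2 := by
      rw [le_div_iff₀ two_pos, mul_two]; exact add_le_add_right hab a
    have hmb : (a + b) / 2 ≤ b := by
      rw [div_le_iff₀ two_pos, mul_two]; exact add_le_add_left hab b
    have h1 := ih a _ ham fun u hu => h u ⟨hu.1, hu.2.trans hmb⟩
    have h2 := ih _ b hmb fun u hu => h u ⟨ham.trans hu.1, hu.2⟩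
    have e : ((((a + b) / 2 : ℝ≥0)) : ℝ) = ((a : ℝ) + b) / 2 := by push_cast; rfl
    rw [e] at h1 h2
    have e1 : K * (((a : ℝ) + b) / 2 - a) / 2 ^ N = K * (b - a) / 2 ^ (N + 1) := by
      rw [pow_succ]; field_simp; ring
    have e2 : K * ((b : ℝ) - ((a : ℝ) + b) / 2) / 2 ^ N = K * (b - a) / 2 ^ (N + 1) := by
      rw [pow_succ]; field_simp; ring
    rw [e1] at h1
    rw [e2] at h2
    have := hδ.le_gromovProduct h1 h2
    push_cast
    linarith

end GromovProduct

/-! ### Stability of quasi-geodesic rays -/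

section Stability

variable {X : Type*} [MetricSpace X]

lemma NNReal.dist_of_le {s t : ℝ≥0} (h : s ≤ t) : dist s t = (t : ℝ) - s := by
  rw [dist_comm, NNReal.dist_eq, abs_of_nonneg (sub_nonneg.2 (by exact_mod_cast h))]

lemma IsRay.lower {o : X} {c : QConst} {α : ℝ≥0 → X} (h : IsRay o c α) {s t : ℝ≥0} (hst : s ≤ t) :
    ((t : ℝ) - s) / c.q - c.Q ≤ dist (α s) (α t) := by
  have := (h.2 s t).1
  rwa [NNReal.dist_of_le hst] at this

lemma IsRay.upper {o : X} {c : QConst} {α : ℝ≥0 → X} (h : IsRay o c α) {s t : ℝ≥0} (hst : s ≤ t) :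
    dist (α s) (α t) ≤ c.q * ((t : ℝ) - s) := by
  have := (h.2 s t).2
  rwa [NNReal.dist_of_le hst] at this

lemma QConst.pos (c : QConst) : 0 < c.q := by linarith [c.one_le]

lemma IsRay.dist_le {o : X} {c : QConst} {α : ℝ≥0 → X} (h : IsRay o c α) (s t : ℝ≥0) :
    dist s t ≤ c.q * (dist (α s) (α t) + c.Q) := by
  have := (h.2 s t).1
  rw [sub_le_iff_le_add, div_le_iff₀ c.pos] at this
  linarith

/-- A geodesic joining two points of a quasi-geodesic ray stays close to the ray. -/
lemma IsRay.exists_dist_geodesic_le {δ : ℝ} (hδ : IsHyperbolicConst X δ) {o : X} {c : QConst}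
    {β : ℝ≥0 → X} (hβ : IsRay o c β) {N : ℕ} (hN : 12 * c.q ^ 2 ≤ 2 ^ N) {s t : ℝ≥0} (hst : s ≤ t)
    {g : ℝ → X} (hg0 : g 0 = β s) (hg1 : g (dist (β s) (β t)) = β t)
    (hg : ∀ a ∈ Icc 0 (dist (β s) (β t)), ∀ b ∈ Icc 0 (dist (β s) (β t)),
      dist (g a) (g b) = |a - b|) {τ : ℝ} (hτ : τ ∈ Icc 0 (dist (β s) (β t))) :
    Metric.infDist (g τ) (β '' Icc s t) ≤ c.Q + 2 * (N + 2) * δ := by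
  set l := dist (β s) (β t) with hl
  have hl0 : 0 ≤ l := dist_nonneg
  have hK : IsCompact (β '' Icc s t) := isCompact_Icc.image hβ.continuous
  have hKne : (β '' Icc s t).Nonempty := ⟨β s, mem_image_of_mem _ ⟨le_rfl, hst⟩⟩
  have hgc : ContinuousOn g (Icc 0 l) := by
    have : LipschitzOnWith 1 g (Icc 0 l) := LipschitzOnWith.of_dist_le_mul fun a ha b hb => by
      rw [hg a ha b hb, Real.dist_eq]; simp
    exact this.continuousOn
  -- Work at the point of the geodesic farthest from the ray, at distance `D`. The ray joins
  -- neighbourhoods of two geodesic points on either side of it while staying outside the `D`-ball;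
  -- its length there is linear in `D`, so for large `D` the two sides would have positive Gromov
  -- product seen from `g τ₀`.
  obtain ⟨τ₀, hτ₀, hmax⟩ := isCompact_Icc.exists_isMaxOn ⟨τ, hτ⟩
    ((Metric.continuous_infDist_pt (β '' Icc s t)).comp_continuousOn hgc)
  set D := Metric.infDist (g τ₀) (β '' Icc s t) with hD
  have hDmax : ∀ a ∈ Icc 0 l, Metric.infDist (g a) (β '' Icc s t) ≤ D := fun a ha => hmax ha
  have hD0 : 0 ≤ D := Metric.infDist_nonneg
  have hDle : ∀ u ∈ Icc s t, D ≤ dist (g τ₀) (β u) := fun u hu =>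
    Metric.infDist_le_dist_of_mem (mem_image_of_mem _ hu)
  refine (hDmax τ hτ).trans ?_
  -- points of the ray close to the points of the geodesic at distance `2 D`
  have hleft : ∃ τ₁ ∈ Icc (0 : ℝ) τ₀, ∃ v ∈ Icc s t, τ₀ - τ₁ ≤ 2 * D ∧ dist (g τ₁) (β v) ≤ D ∧
      D ≤ gromovProduct (g τ₀) (g τ₁) (β v) := by
    rcases le_total τ₀ (2 * D) with h | h
    · refine ⟨0, ⟨le_rfl, hτ₀.1⟩, s, ⟨le_rfl, hst⟩, by linarith, by rw [hg0, dist_self]; exact hD0, ?_⟩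
      rw [hg0, gromovProduct_self]; exact hDle s ⟨le_rfl, hst⟩
    · have hm : τ₀ - 2 * D ∈ Icc 0 l := ⟨by linarith, by linarith [hτ₀.2]⟩
      obtain ⟨_, ⟨v, hv, rfl⟩, hv'⟩ := hK.exists_infDist_eq_dist hKne (g (τ₀ - 2 * D))
      have hle : dist (g (τ₀ - 2 * D)) (β v) ≤ D := hv' ▸ hDmax _ hm
      refine ⟨τ₀ - 2 * D, ⟨hm.1, by linarith⟩, v, hv, by linarith, hle, ?_⟩
      have h1 := dist_sub_dist_le_gromovProduct (g τ₀) (g (τ₀ - 2 * D)) (β v)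
      rw [hg _ hτ₀ _ hm, abs_of_nonneg (by linarith)] at h1
      linarith
  have hright : ∃ τ₂ ∈ Icc τ₀ l, ∃ v ∈ Icc s t, τ₂ - τ₀ ≤ 2 * D ∧ dist (g τ₂) (β v) ≤ D ∧
      D ≤ gromovProduct (g τ₀) (g τ₂) (β v) := by
    rcases le_total (l - τ₀) (2 * D) with h | h
    · refine ⟨l, ⟨hτ₀.2, le_rfl⟩, t, ⟨hst, le_rfl⟩, by linarith, by rw [hg1, dist_self]; exact hD0, ?_⟩
      rw [hg1, gromovProduct_self]; exact hDle t ⟨hst, le_rfl⟩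
    · have hm : τ₀ + 2 * D ∈ Icc 0 l := ⟨by linarith [hτ₀.1], by linarith⟩
      obtain ⟨_, ⟨v, hv, rfl⟩, hv'⟩ := hK.exists_infDist_eq_dist hKne (g (τ₀ + 2 * D))
      have hle : dist (g (τ₀ + 2 * D)) (β v) ≤ D := hv' ▸ hDmax _ hm
      refine ⟨τ₀ + 2 * D, ⟨by linarith, hm.2⟩, v, hv, by linarith, hle, ?_⟩
      have h1 := dist_sub_dist_le_gromovProduct (g τ₀) (g (τ₀ + 2 * D)) (β v)
      rw [hg _ hτ₀ _ hm, abs_sub_comm, abs_of_nonneg (by linarith)] at h1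
      linarith
  obtain ⟨τ₁, hτ₁, v₁, hv₁, hd₁, hb₁, hp₁⟩ := hleft
  obtain ⟨τ₂, hτ₂, v₂, hv₂, hd₂, hb₂, hp₂⟩ := hright
  have hm₁ : τ₁ ∈ Icc 0 l := ⟨hτ₁.1, hτ₁.2.trans hτ₀.2⟩
  have hm₂ : τ₂ ∈ Icc 0 l := ⟨hτ₀.1.trans hτ₂.1, hτ₂.2⟩
  have hd : dist (g τ₁) (g τ₂) ≤ 4 * D := by
    rw [hg _ hm₁ _ hm₂, abs_sub_comm, abs_of_nonneg (by linarith [hτ₁.2, hτ₂.1])]; linarith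
  have h0 : gromovProduct (g τ₀) (g τ₁) (g τ₂) = 0 := by
    unfold gromovProduct
    rw [hg _ hτ₀ _ hm₁, hg _ hτ₀ _ hm₂, hg _ hm₁ _ hm₂, abs_of_nonneg (by linarith [hτ₁.2]),
      abs_sub_comm, abs_of_nonneg (by linarith [hτ₂.1]), abs_sub_comm,
      abs_of_nonneg (by linarith [hτ₁.2, hτ₂.1])]
    ring
  have hq := c.pos
  have hdv : dist v₁ v₂ ≤ c.q * (6 * D + c.Q) := by
    refine (hβ.dist_le v₁ v₂).trans (mul_le_mul_of_nonneg_left ?_ hq.le)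
    have := dist_triangle4 (β v₁) (g τ₁) (g τ₂) (β v₂)
    rw [dist_comm (β v₁) (g τ₁)] at this
    linarith
  have h2N : (0 : ℝ) < 2 ^ N := by positivity
  have hpath : D - c.q * dist v₁ v₂ / 2 ^ N - N * δ ≤ gromovProduct (g τ₀) (β v₁) (β v₂) := by
    rcases le_total v₁ v₂ with h | h
    · rw [NNReal.dist_of_le h]
      exact le_gromovProduct_of_path hδ (fun a b => (hβ.2 a b).2) N v₁ v₂ h
        fun u hu => hDle u ⟨hv₁.1.trans hu.1, hu.2.trans hv₂.2⟩
    · rw [dist_comm, NNReal.dist_of_le h, gromovProduct_comm]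
      exact le_gromovProduct_of_path hδ (fun a b => (hβ.2 a b).2) N v₂ v₁ h
        fun u hu => hDle u ⟨hv₂.1.trans hu.1, hu.2.trans hv₁.2⟩
  -- The choice of `N` makes the length term at most `D / 2 + c.Q / 12`, so half of `D` survives.
  have hfrac : c.q * dist v₁ v₂ / 2 ^ N ≤ (6 * D + c.Q) / 12 := by
    rw [div_le_div_iff₀ h2N (by norm_num)]
    have h1 : c.q * dist v₁ v₂ ≤ c.q * (c.q * (6 * D + c.Q)) := mul_le_mul_of_nonneg_left hdv hq.le
    have h2 : (6 * D + c.Q) * (12 * c.q ^ 2) ≤ (6 * D + c.Q) * 2 ^ N :=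
      mul_le_mul_of_nonneg_left hN (by linarith [c.nonneg])
    linarith
  have hNδ : 0 ≤ (N : ℝ) * δ := mul_nonneg (Nat.cast_nonneg _) hδ.1
  have hfrac0 : 0 ≤ c.q * dist v₁ v₂ / 2 ^ N :=
    div_nonneg (mul_nonneg hq.le dist_nonneg) h2N.le
  have h3 := hδ.le_gromovProduct (w := g τ₀) (x := β v₁) (y := β v₂) (z := g τ₂)
    hpath (by rw [gromovProduct_comm]; linarith)
  have h4 := hδ.le_gromovProduct (w := g τ₀) (x := g τ₁) (y := β v₁) (z := g τ₂)
    (by linarith [hδ.1]) h3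
  rw [h0] at h4
  linarith [c.nonneg]

/-- Stability of quasi-geodesic rays: a point of the ray is close to the geodesics that join an
earlier point to a later one. -/
lemma exists_gromovProduct_le [GromovHyperbolic X] (hgeo : IsGeodesicSpace X) (c : QConst) :
    ∃ C : ℝ, 0 ≤ C ∧ ∀ (o : X) (β : ℝ≥0 → X), IsRay o c β → ∀ s u t : ℝ≥0, s ≤ u → u ≤ t →
      gromovProduct (β u) (β s) (β t) ≤ C := by
  obtain ⟨δ, hδ⟩ := exists_isHyperbolicConst X
  obtain ⟨N, hN⟩ := pow_unbounded_of_one_lt (12 * c.q ^ 2) (one_lt_two : (1 : ℝ) < 2)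
  set E := c.Q + 2 * (N + 2) * δ with hE
  have hE0 : 0 ≤ E := by
    have := hδ.1
    have := c.nonneg
    positivity
  have hq := c.pos
  have hQ := c.nonneg
  refine ⟨c.q * (c.q * (2 * E + c.Q)) + E, by positivity, fun o β hβ s u t hsu hut => ?_⟩
  obtain ⟨g, hg0, hg1, hg⟩ := hgeo (β s) (β t)
  set l := dist (β s) (β t) with hl
  have hl0 : 0 ≤ l := dist_nonneg
  have hgc : ContinuousOn g (Icc 0 l) := by
    have : LipschitzOnWith 1 g (Icc 0 l) := LipschitzOnWith.of_dist_le_mul fun a ha b hb => by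
      rw [hg a ha b hb, Real.dist_eq]; simp
    exact this.continuousOn
  have hK₁ : IsCompact (β '' Icc s u) := isCompact_Icc.image hβ.continuous
  have hK₂ : IsCompact (β '' Icc u t) := isCompact_Icc.image hβ.continuous
  have hne₁ : (β '' Icc s u).Nonempty := ⟨β s, mem_image_of_mem _ ⟨le_rfl, hsu⟩⟩
  have hne₂ : (β '' Icc u t).Nonempty := ⟨β t, mem_image_of_mem _ ⟨hut, le_rfl⟩⟩
  -- The geodesic starts on the first arc of the ray and ends on the second, so some point is
  -- equidistant from both. Being close to the union, it is close to a point on each; these are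
  -- close in time, and `u` lies between them.
  obtain ⟨τ, hτ, hτeq⟩ : ∃ τ ∈ Icc 0 l,
      Metric.infDist (g τ) (β '' Icc s u) - Metric.infDist (g τ) (β '' Icc u t) = 0 := by
    have hcont : ContinuousOn (fun τ => Metric.infDist (g τ) (β '' Icc s u) -
        Metric.infDist (g τ) (β '' Icc u t)) (Icc 0 l) :=
      ((Metric.continuous_infDist_pt _).comp_continuousOn hgc).sub
        ((Metric.continuous_infDist_pt _).comp_continuousOn hgc)
    have := intermediate_value_Icc hl0 hcont
    obtain ⟨τ, hτ, h⟩ := this (show (0 : ℝ) ∈ _ by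
      constructor
      · rw [hg0, Metric.infDist_zero_of_mem (s := β '' Icc s u)
          (mem_image_of_mem _ ⟨le_rfl, hsu⟩)]
        linarith [Metric.infDist_nonneg (x := β s) (s := β '' Icc u t)]
      · rw [hg1, Metric.infDist_zero_of_mem (x := β t) (s := β '' Icc u t)
          (mem_image_of_mem _ ⟨hut, le_rfl⟩)]
        linarith [Metric.infDist_nonneg (x := β t) (s := β '' Icc s u)])
    exact ⟨τ, hτ, h⟩
  have hnear : Metric.infDist (g τ) (β '' Icc s t) ≤ E :=
    hβ.exists_dist_geodesic_le hδ hN.le (hsu.trans hut) hg0 hg1 hg hτ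
  obtain ⟨_, ⟨v, hv, rfl⟩, hv'⟩ := hK₁.exists_infDist_eq_dist hne₁ (g τ)
  obtain ⟨_, ⟨w, hw, rfl⟩, hw'⟩ := hK₂.exists_infDist_eq_dist hne₂ (g τ)
  have hvE : dist (g τ) (β v) ≤ E := by
    obtain ⟨_, ⟨x, hx, rfl⟩, hx'⟩ := ((isCompact_Icc (a := s) (b := t)).image
      hβ.continuous).exists_infDist_eq_dist
      ⟨β s, mem_image_of_mem β (show s ∈ Icc s t from ⟨le_rfl, hsu.trans hut⟩)⟩ (g τ)
    rw [hx'] at hnear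
    rcases le_total x u with h | h
    · linarith [Metric.infDist_le_dist_of_mem (x := g τ)
        (mem_image_of_mem β (show x ∈ Icc s u from ⟨hx.1, h⟩))]
    · linarith [Metric.infDist_le_dist_of_mem (x := g τ)
        (mem_image_of_mem β (show x ∈ Icc u t from ⟨h, hx.2⟩))]
  have hwE : dist (g τ) (β w) ≤ E := by linarith
  have hvw : dist v w ≤ c.q * (2 * E + c.Q) := by
    refine (hβ.dist_le v w).trans (mul_le_mul_of_nonneg_left ?_ hq.le)
    linarith [dist_triangle_left (β v) (β w) (g τ)]
  have hvu : dist v u ≤ dist v w := by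
    rw [NNReal.dist_of_le hv.2, NNReal.dist_of_le (hv.2.trans hw.1)]
    have : (u : ℝ) ≤ w := by exact_mod_cast hw.1
    linarith
  have hu : dist (β u) (g τ) ≤ c.q * (c.q * (2 * E + c.Q)) + E := by
    have h1 := dist_triangle_left (β u) (g τ) (β v)
    have h2 := (hβ.2 v u).2
    have h3 : c.q * dist v u ≤ c.q * (c.q * (2 * E + c.Q)) :=
      mul_le_mul_of_nonneg_left (hvu.trans hvw) hq.le
    rw [dist_comm (β v) (g τ)] at h1
    linarith
  have h1 := dist_triangle (β u) (g τ) (β s)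
  have h2 := dist_triangle (β u) (g τ) (β t)
  rw [← hg0, hg τ hτ 0 ⟨le_rfl, hl0⟩, sub_zero, abs_of_nonneg hτ.1, hg0] at h1
  rw [← hg1, hg τ hτ l ⟨hl0, le_rfl⟩, abs_sub_comm, abs_of_nonneg (by linarith [hτ.2]), hg1] at h2
  unfold gromovProduct
  linarith

/-- Along a quasi-geodesic ray the Gromov product of two points is almost the distance of the
first one from the base point. -/
lemma exists_norm_sub_le_gromovProduct [GromovHyperbolic X] (hgeo : IsGeodesicSpace X)
    (c : QConst) : ∃ C : ℝ, 0 ≤ C ∧ ∀ (o : X) (β : ℝ≥0 → X), IsRay o c β → ∀ s t : ℝ≥0, s ≤ t →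
      gromovProduct (β s) o (β t) ≤ C ∧ dist o (β s) - C ≤ gromovProduct o (β s) (β t) := by
  obtain ⟨C, hC0, hC⟩ := exists_gromovProduct_le hgeo c
  refine ⟨C, hC0, fun o β hβ s t hst => ?_⟩
  have h := hC o β hβ 0 s t zero_le hst
  rw [hβ.1] at h
  exact ⟨h, by rw [gromovProduct_eq_sub]; linarith⟩

end Stability

/-! ### Concatenation of paths -/

section Paths

variable {X : Type*}

/-- Follow `α` up to time `T`, then `η`. -/
noncomputable def glue (α : ℝ≥0 → X) (T : ℝ≥0) (η : ℝ≥0 → X) : ℝ≥0 → X :=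
  fun t => if t ≤ T then α t else η (t - T)

lemma glue_of_le {α η : ℝ≥0 → X} {T t : ℝ≥0} (h : t ≤ T) : glue α T η t = α t := if_pos h

lemma glue_add {α η : ℝ≥0 → X} {T : ℝ≥0} (h : α T = η 0) (v : ℝ≥0) :
    glue α T η (T + v) = η v := by
  rcases eq_or_ne v 0 with rfl | hv
  · rw [add_zero, glue_of_le le_rfl, h]
  · have : ¬ T + v ≤ T := by
      rw [not_le]; exact lt_add_of_pos_right T (pos_iff_ne_zero.2 hv)
    rw [glue, if_neg this, add_tsub_cancel_left]

lemma EventuallyCoincide.trans {α β γ : ℝ≥0 → X} (h : EventuallyCoincide α β)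
    (h' : EventuallyCoincide β γ) : EventuallyCoincide α γ := by
  obtain ⟨s, u, h⟩ := h
  obtain ⟨s', u', h'⟩ := h'
  refine ⟨s + s', u' + u, fun t => ?_⟩
  rw [add_assoc, h, add_assoc u', ← h']
  congr 1
  ring

end Paths

/-! ### Gluing quasi-geodesics, exit times and geodesic rays -/

section Gluing

variable {X : Type*} [MetricSpace X]

/-- The quasi-geodesic inequalities on a set of times. -/
def QIOn (c : QConst) (S : Set ℝ≥0) (α : ℝ≥0 → X) : Prop :=
  ∀ s ∈ S, ∀ t ∈ S, s ≤ t → ((t : ℝ) - s) / c.q - c.Q ≤ dist (α s) (α t) ∧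
    dist (α s) (α t) ≤ c.q * ((t : ℝ) - s)

lemma IsRay.qiOn {o : X} {c : QConst} {α : ℝ≥0 → X} (h : IsRay o c α) (S : Set ℝ≥0) :
    QIOn c S α :=
  fun _ _ _ _ hst => ⟨h.lower hst, h.upper hst⟩

lemma QIOn.isRay {o : X} {c : QConst} {α : ℝ≥0 → X} (h : QIOn c univ α) (h0 : α 0 = o) :
    IsRay o c α := by
  refine ⟨h0, fun s t => ?_⟩
  rcases le_total s t with hst | hst
  · rw [NNReal.dist_of_le hst]; exact h s trivial t trivial hst
  · rw [dist_comm s t, dist_comm (α s), NNReal.dist_of_le hst]; exact h t trivial s trivial hst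

lemma QIOn.shift {c : QConst} {α : ℝ≥0 → X} (h : QIOn c univ α) (u : ℝ≥0) :
    QIOn c univ fun v => α (u + v) := by
  intro s _ t _ hst
  have := h (u + s) trivial (u + t) trivial (add_le_add_right hst u)
  rwa [NNReal.coe_add, NNReal.coe_add, add_sub_add_left_eq_sub] at this

lemma QConst.div_le {c : QConst} {x : ℝ} (hx : 0 ≤ x) : x / c.q ≤ x :=
  div_le_self hx c.one_le

/-- The upper bound across the junction follows from the triangle inequality through the common
point; only the lower bound needs a hypothesis. -/
lemma QIOn.glue {c : QConst} {α η : ℝ≥0 → X} {T : ℝ≥0} (hα : QIOn c (Iic T) α)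
    (hη : QIOn c univ η) (h : α T = η 0)
    (hcross : ∀ s ≤ T, ∀ v : ℝ≥0, ((T : ℝ) - s + v) / c.q - c.Q ≤ dist (α s) (η v)) :
    QIOn c univ (glue α T η) := by
  intro s _ t _ hst
  rcases le_total t T with ht | ht
  · rw [glue_of_le ht, glue_of_le (hst.trans ht)]
    exact hα s (hst.trans ht) t ht hst
  obtain ⟨v, rfl⟩ := exists_add_of_le ht
  rcases le_total s T with hs | hs
  · rw [glue_of_le hs, glue_add h]
    refine ⟨?_, ?_⟩
    · have := hcross s hs v
      rwa [NNReal.coe_add, add_sub_right_comm]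
    · have h1 := (hα s hs T (mem_Iic.2 le_rfl) hs).2
      have h2 := (hη 0 trivial v trivial zero_le).2
      have h3 := dist_triangle (α s) (α T) (η v)
      rw [← h] at h2
      simp only [NNReal.coe_zero, sub_zero] at h2
      rw [NNReal.coe_add]
      linarith
  · obtain ⟨w, rfl⟩ := exists_add_of_le hs
    rw [glue_add h, glue_add h, NNReal.coe_add, NNReal.coe_add, add_sub_add_left_eq_sub]
    exact hη w trivial v trivial (le_of_add_le_add_left hst)

/-- Precede `η` by a geodesic segment from `x` to its starting point. -/
lemma exists_prepend_segment (hgeo : IsGeodesicSpace X) {c : QConst} (x : X) {η : ℝ≥0 → X}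
    (hη : QIOn c univ η)
    (hcross : ∀ (z : X) (v : ℝ≥0), dist x z + dist z (η 0) = dist x (η 0) →
      (dist z (η 0) + v) / c.q - c.Q ≤ dist z (η v)) :
    ∃ ζ : ℝ≥0 → X, ζ 0 = x ∧ QIOn c univ ζ ∧ (∀ v, ζ (nndist x (η 0) + v) = η v) ∧
      ∀ a ≤ nndist x (η 0), dist x (ζ a) = a ∧ dist (ζ a) (η 0) = dist x (η 0) - a := by
  -- As the segment is chosen only here, `hcross` is imposed on all points metrically between its
  -- ends.
  obtain ⟨g, hg0, hg1, hg⟩ := hgeo x (η 0)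
  have hmem : ∀ a ≤ nndist x (η 0), (a : ℝ) ∈ Icc 0 (dist x (η 0)) := fun a ha =>
    ⟨a.2, by exact_mod_cast ha⟩
  have hg1' : (fun a : ℝ≥0 => g a) (nndist x (η 0)) = η 0 := hg1
  have hd0 : ∀ a ≤ nndist x (η 0), dist x (g a) = a := fun a ha => by
    rw [← hg0, hg 0 ⟨le_rfl, dist_nonneg⟩ a (hmem a ha), zero_sub, abs_neg, abs_of_nonneg a.coe_nonneg]
  have hd1 : ∀ a ≤ nndist x (η 0), dist (g a) (η 0) = dist x (η 0) - a := fun a ha => by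
    nth_rw 1 [← hg1]
    rw [hg a (hmem a ha) _ ⟨dist_nonneg, le_rfl⟩, abs_sub_comm,
      abs_of_nonneg (by linarith [(hmem a ha).2])]
  refine ⟨glue (fun a => g a) (nndist x (η 0)) η, ?_, ?_, glue_add hg1', fun a ha => ?_⟩
  · rw [glue_of_le zero_le]; exact hg0
  · refine QIOn.glue (fun s hs t ht hst => ?_) hη hg1' fun s hs v => ?_
    · have h1 : (s : ℝ) ≤ t := by exact_mod_cast hst
      rw [hg s (hmem s hs) t (hmem t ht), abs_sub_comm, abs_of_nonneg (by linarith)]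
      have h2 := QConst.div_le (c := c) (sub_nonneg.2 h1)
      have h3 := mul_le_mul_of_nonneg_right c.one_le (sub_nonneg.2 h1)
      exact ⟨by linarith [c.nonneg], by linarith⟩
    · have h1 := hcross (g s) v (by rw [hd0 s hs, hd1 s hs]; ring)
      rwa [hd1 s hs] at h1
  · rw [glue_of_le ha]
    exact ⟨hd0 a ha, hd1 a ha⟩

lemma IsRay.norm_le_of_le_hitTime {o : X} {c : QConst} {α : ℝ≥0 → X} (h : IsRay o c α) {r : ℝ}
    (hr : 0 ≤ r) {s : ℝ≥0} (hs : s ≤ hitTime o r α) : dist o (α s) ≤ r := by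
  have hlt : ∀ u < hitTime o r α, dist o (α u) ≤ r := fun u hu => by
    by_contra hcon
    exact absurd (hitTime_le (not_le.1 hcon).le) (not_le.2 hu)
  rcases hs.lt_or_eq with hs | rfl
  · exact hlt s hs
  rcases eq_or_ne (hitTime o r α) 0 with h0 | h0
  · rw [h0, h.1, dist_self]; exact hr
  have hcl : IsClosed {u : ℝ≥0 | dist o (α u) ≤ r} :=
    isClosed_le (continuous_const.dist h.continuous) continuous_const
  have hsub : closure (Iio (hitTime o r α)) ⊆ {u : ℝ≥0 | dist o (α u) ≤ r} :=
    closure_minimal hlt hcl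
  rw [closure_Iio' ⟨0, pos_iff_ne_zero.2 h0⟩] at hsub
  exact hsub (mem_Iic.2 le_rfl)

lemma IsRay.norm_hitTime {o : X} {c : QConst} {α : ℝ≥0 → X} (h : IsRay o c α) {r : ℝ}
    (hr : 0 ≤ r) : dist o (α (hitTime o r α)) = r :=
  le_antisymm (h.norm_le_of_le_hitTime hr le_rfl) (h.le_norm_hitTime r)

lemma IsRay.hitTime_le_mul {o : X} {c : QConst} {α : ℝ≥0 → X} (h : IsRay o c α) {r : ℝ}
    (hr : 0 ≤ r) : (hitTime o r α : ℝ) ≤ c.q * (r + c.Q) := by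
  have h1 := h.le_norm (hitTime o r α)
  rw [h.norm_hitTime hr, sub_le_iff_le_add, div_le_iff₀ c.pos] at h1
  linarith

/-- The constants of geodesic rays. -/
def QConst.geodesic : QConst := ⟨1, 0, le_rfl, le_rfl⟩

lemma QConst.geodesic_q : QConst.geodesic.q = 1 := rfl

lemma QConst.geodesic_Q : QConst.geodesic.Q = 0 := rfl

lemma IsRay.of_geodesic {o : X} {ω : ℝ≥0 → X} (h : IsRay o .geodesic ω) (c : QConst) :
    IsRay o c ω :=
  h.mono c.one_le c.nonneg

lemma IsRay.dist_geodesic {o : X} {ω : ℝ≥0 → X} (h : IsRay o .geodesic ω) {s t : ℝ≥0}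
    (hst : s ≤ t) : dist (ω s) (ω t) = t - s := by
  have h1 := h.lower hst
  have h2 := h.upper hst
  rw [QConst.geodesic_q] at h1 h2
  rw [QConst.geodesic_Q] at h1
  linarith

lemma IsRay.norm_geodesic {o : X} {ω : ℝ≥0 → X} (h : IsRay o .geodesic ω) (t : ℝ≥0) :
    dist o (ω t) = t := by
  have := h.dist_geodesic (zero_le (a := t))
  rwa [h.1, NNReal.coe_zero, sub_zero] at this

end Gluing

/-! ### Redirection to geodesic rays and transitivity with control of the constants -/

section Redirecting

variable {X : Type*} [MetricSpace X] {o : X}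

/-- A quasi-geodesic ray can be redirected, almost without loss in the constants, to a geodesic
ray which it approaches. -/
lemma redirectsAt_geodesic (hgeo : IsGeodesicSpace X) {c c' : QConst} {β ω : ℝ≥0 → X}
    (hβ : IsRay o c β) (hω : IsRay o .geodesic ω) (hq : c.q ≤ c'.q) (hQ : c.Q ≤ c'.Q)
    (hQ1 : 1 ≤ c'.Q) {r : ℝ} {S P : ℝ≥0}
    (h : dist (β S) (ω P) - P + S / c'.q < -r - 1) : RedirectsAt o c' r β ω := by
  have hq' := c'.pos
  -- At a minimum `(s₀, p₀)` of `Ψ`, moving back along `β` or along `ω` cannot lessen the distance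
  -- faster than the lower quasi-geodesic bound permits, so jumping from `β s₀` to `ω p₀` is
  -- harmless. A minimum up to `1` suffices, as `1 ≤ c'.Q`.
  let Ψ : ℝ≥0 × ℝ≥0 → ℝ := fun x => dist (β x.1) (ω x.2) - x.2 + x.1 / c'.q
  have hlow : ∀ s p : ℝ≥0, -dist o (β s) ≤ Ψ (s, p) := fun s p => by
    have h1 := dist_triangle o (β s) (ω p)
    rw [hω.norm_geodesic] at h1
    have h2 : (0 : ℝ) ≤ s / c'.q := div_nonneg s.2 hq'.le
    change _ ≤ dist (β s) (ω p) - p + s / c'.q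
    linarith
  have hbdd : BddBelow (Ψ '' (Iic S ×ˢ univ)) := by
    refine ⟨-(c.q * S), ?_⟩
    rintro _ ⟨⟨s, p⟩, ⟨hs, -⟩, rfl⟩
    have h1 := hβ.norm_le s
    have h2 : c.q * (s : ℝ) ≤ c.q * S :=
      mul_le_mul_of_nonneg_left (by exact_mod_cast hs) c.pos.le
    linarith [hlow s p]
  obtain ⟨_, ⟨⟨s₀, p₀⟩, ⟨hs₀, -⟩, rfl⟩, hlt⟩ := exists_lt_of_csInf_lt
    (⟨Ψ (S, P), mem_image_of_mem _ ⟨mem_Iic.2 le_rfl, trivial⟩⟩ : (Ψ '' (Iic S ×ˢ univ)).Nonempty)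
    (lt_add_one (sInf (Ψ '' (Iic S ×ˢ univ))))
  have hmin : ∀ s ≤ S, ∀ p : ℝ≥0, Ψ (s₀, p₀) ≤ Ψ (s, p) + 1 := fun s hs p => by
    have := csInf_le hbdd (mem_image_of_mem Ψ (show (s, p) ∈ Iic S ×ˢ univ from ⟨hs, trivial⟩))
    linarith
  -- `Ψ (s, p) ≥ -‖β s‖`, so a value below `-r` is only reached outside the ball of radius `r`.
  have hfar : hitTime o r β ≤ s₀ := by
    refine hitTime_le ?_
    have h1 := hmin S le_rfl P
    have h2 := hlow s₀ p₀
    change Ψ (S, P) < -r - 1 at h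
    linarith
  have hdist : ∀ s ≤ s₀, ∀ p : ℝ≥0, dist (β s₀) (ω p₀) + (p - p₀) + (s₀ - s) / c'.q - 1 ≤
      dist (β s) (ω p) := fun s hs p => by
    have h1 := hmin s (hs.trans hs₀) p
    change dist (β s₀) (ω p₀) - p₀ + s₀ / c'.q ≤ dist (β s) (ω p) - p + s / c'.q + 1 at h1
    rw [sub_div]
    linarith
  obtain ⟨ζ, hζ0, hζ, hζω, hζd⟩ := exists_prepend_segment hgeo (c := c') (β s₀)
    (η := fun v => ω (p₀ + v)) (((hω.of_geodesic c').qiOn univ).shift p₀) fun z v hz => by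
      simp only [add_zero] at hz ⊢
      have h1 := hdist s₀ le_rfl (p₀ + v)
      have h2 := dist_triangle (β s₀) z (ω (p₀ + v))
      have h3 := QConst.div_le (c := c')
        (show 0 ≤ dist z (ω p₀) + v from add_nonneg dist_nonneg v.coe_nonneg)
      rw [sub_self, zero_div, NNReal.coe_add] at h1
      linarith
  simp only [add_zero] at hζω hζd
  have hζ0' : β s₀ = ζ 0 := hζ0.symm
  have hray : IsRay o c' (glue β s₀ ζ) := by
    refine (QIOn.glue ((hβ.mono hq hQ).qiOn _) hζ hζ0' fun s hs v => ?_).isRay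
      (by rw [glue_of_le zero_le, hβ.1])
    rw [add_div]
    have h3 := QConst.div_le (c := c') v.coe_nonneg
    rcases le_total v (nndist (β s₀) (ω p₀)) with hv | hv
    · have h1 := hdist s hs p₀
      have h2 := dist_triangle (β s) (ζ v) (ω p₀)
      rw [(hζd v hv).2] at h2
      rw [sub_self] at h1
      linarith
    · obtain ⟨w, rfl⟩ := exists_add_of_le hv
      have h1 := hdist s hs (p₀ + w)
      rw [hζω]
      rw [NNReal.coe_add] at h1
      rw [NNReal.coe_add, coe_nndist] at h3 ⊢
      linarith
  refine ⟨glue β s₀ ζ, hray, .of_eq hray hβ fun t ht => glue_of_le (ht.trans hfar),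
    s₀ + nndist (β s₀) (ω p₀), p₀, fun t => ?_⟩
  rw [add_assoc, glue_add hζ0', hζω]

/-- At small radii, one may return to the base point before following a geodesic ray. -/
lemma redirectsAt_geodesic_of_le (hgeo : IsGeodesicSpace X) {c c' : QConst} {β ω : ℝ≥0 → X}
    (hβ : IsRay o c β) (hω : IsRay o .geodesic ω) (hq : c'.q = c.q + 1) (hQ : c'.Q = c.q + c.Q)
    {r : ℝ} (hr : 0 < r) (h : 2 * r ≤ c.q + c.Q / (c.q + 1)) : RedirectsAt o c' r β ω := by
  have hq1 := c.one_le
  have hQ0 := c.nonneg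
  have hpos : 0 < c.q + 1 := by linarith
  set T := hitTime o r β with hT
  have hTn : dist o (β T) = r := hβ.norm_hitTime hr.le
  have hTle : (T : ℝ) ≤ c.q * (r + c.Q) := hβ.hitTime_le_mul hr.le
  have hsplit : c.Q = c.Q / (c.q + 1) + c.q * c.Q / (c.q + 1) := by field_simp; ring
  have hnn : 0 ≤ c.q * c.Q / (c.q + 1) := by positivity
  have hconst : (T + r) / (c.q + 1) ≤ r + c.q * c.Q / (c.q + 1) := by
    rw [div_le_iff₀ hpos, add_mul, div_mul_cancel₀ _ hpos.ne']
    linarith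
  -- `T + r` is the time spent before being back at `o`, and the last `r` bounds the norm of the
  -- points met meanwhile: this is the whole additive loss.
  have hkey : (T + r) / c'.q + r ≤ c'.Q := by
    rw [hq, hQ]; linarith
  have hT0 : 0 ≤ (T : ℝ) / c'.q := div_nonneg T.coe_nonneg c'.pos.le
  rw [add_div] at hkey
  obtain ⟨ζ, hζ0, hζ, hζω, -⟩ := exists_prepend_segment hgeo (c := c') (β T)
    (η := ω) ((hω.of_geodesic c').qiOn univ) fun z v hz => by
      have h1 := dist_triangle o z (ω v)
      rw [hω.norm_geodesic] at h1
      rw [hω.1, dist_comm (β T) o, hTn, dist_comm z o] at hz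
      rw [hω.1, dist_comm z o, add_div]
      have h2 : dist o z ≤ r := by linarith [dist_nonneg (x := β T) (y := z)]
      have h3 := div_le_div_of_nonneg_right h2 c'.pos.le
      have h4 := QConst.div_le (c := c') v.coe_nonneg
      linarith
  have hL : (nndist (β T) (ω 0) : ℝ) = r := by rw [coe_nndist, hω.1, dist_comm, hTn]
  have hζ0' : β T = ζ 0 := hζ0.symm
  have hray : IsRay o c' (glue β T ζ) := by
    refine (QIOn.glue ((hβ.mono (by linarith) (by linarith)).qiOn _) hζ hζ0' fun s hs v =>
      ?_).isRay (by rw [glue_of_le zero_le, hβ.1])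
    have hs0 : 0 ≤ (s : ℝ) / c'.q := div_nonneg s.coe_nonneg c'.pos.le
    rw [add_div, sub_div]
    rcases le_total v (nndist (β T) (ω 0)) with hv | hv
    · have h1 : (v : ℝ) ≤ r := by rw [← hL]; exact_mod_cast hv
      have h2 := div_le_div_of_nonneg_right h1 c'.pos.le
      linarith [dist_nonneg (x := β s) (y := ζ v)]
    · obtain ⟨w, rfl⟩ := exists_add_of_le hv
      have h1 := dist_triangle o (β s) (ω w)
      rw [hω.norm_geodesic] at h1
      have h2 := hβ.norm_le_of_le_hitTime hr.le hs
      have h3 := QConst.div_le (c := c') w.coe_nonneg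
      rw [hζω, NNReal.coe_add, hL, add_div]
      linarith
  refine ⟨glue β T ζ, hray, .of_eq hray hβ fun t ht => glue_of_le ht,
    T + nndist (β T) (ω 0), 0, fun t => ?_⟩
  rw [add_assoc, glue_add hζ0', hζω, zero_add]

/-- Every geodesic ray can be modified so as to pass through a given point. -/
lemma exists_isRay_through (hgeo : IsGeodesicSpace X) {ω : ℝ≥0 → X} (hω : IsRay o .geodesic ω)
    {c : QConst} {x : X} (hc : 3 * dist o x ≤ c.Q) :
    ∃ β : ℝ≥0 → X, IsRay o c β ∧ x ∈ range β ∧ EventuallyCoincide β ω := by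
  -- The path runs from `o` to `x`, back to `o`, then along `ω`. The detour costs at most `2 * dist
  -- o x` in the additive constant.
  obtain ⟨ζ, hζ0, hζ, hζω, hζd⟩ := exists_prepend_segment hgeo (c := c) x
    (η := ω) ((hω.of_geodesic c).qiOn univ) fun z v hz => by
      have h1 := dist_triangle o z (ω v)
      rw [hω.norm_geodesic] at h1
      rw [hω.1, dist_comm x o, dist_comm z o] at hz
      have h3 := QConst.div_le (c := c) (add_nonneg (dist_nonneg (x := z) (y := o)) v.coe_nonneg)
      rw [hω.1]
      rw [dist_comm z o] at h3 ⊢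
      linarith [dist_nonneg (x := x) (y := z), dist_nonneg (x := o) (y := x)]
  obtain ⟨β, hβ0, hβ, hβζ, -⟩ := exists_prepend_segment hgeo (c := c) o (η := ζ) hζ fun z v hz => by
      rw [hζ0] at hz ⊢
      have h3 := QConst.div_le (c := c) (add_nonneg (dist_nonneg (x := z) (y := x)) v.coe_nonneg)
      rcases le_total v (nndist x (ω 0)) with hv | hv
      · have h1 : (v : ℝ) ≤ dist o x := by
          rw [dist_comm, ← hω.1]; exact_mod_cast hv
        linarith [dist_nonneg (x := z) (y := ζ v), dist_nonneg (x := o) (y := z)]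
      · obtain ⟨w, rfl⟩ := exists_add_of_le hv
        have h1 := dist_triangle o z (ω w)
        rw [hω.norm_geodesic] at h1
        rw [NNReal.coe_add, coe_nndist, hω.1, dist_comm x o] at h3 ⊢
        rw [← hω.1, hζω]
        rw [← hω.1] at h1 h3 hz hc
        linarith [dist_nonneg (x := ω 0) (y := x)]
  refine ⟨β, hβ.isRay hβ0, ⟨nndist o (ζ 0) + 0, by rw [hβζ, hζ0]⟩,
    nndist o (ζ 0) + nndist x (ω 0), 0, fun t => ?_⟩
  rw [add_assoc, hβζ, hζω, zero_add]

/-- Redirecting to a ray which in turn can be redirected at every radius. -/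
lemma RedirectsAt.trans {c c₁ c₂ cβ cω : QConst} {r : ℝ} {β ω α : ℝ≥0 → X}
    (hβ : IsRay o cβ β) (hω : IsRay o cω ω) (h₁ : RedirectsAt o c₁ r β ω)
    (h₂ : ∀ r : ℝ, 0 < r → RedirectsAt o c₂ r ω α) (hq₁ : c₁.q ≤ c.q) (hQ₁ : c₁.Q ≤ c.Q)
    (hq₂ : c₂.q < c.q) (hQ₂ : c₂.Q ≤ c.Q) : RedirectsAt o c r β α := by
  have hc := c.pos
  have hc₂ := c₂.pos
  obtain ⟨ζ₁, hζ₁, ha₁, s₁, u₁, he₁⟩ := h₁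
  have hgap : 0 < 1 / c₂.q - 1 / c.q := sub_pos.2 (one_div_lt_one_div_of_lt hc₂ hq₂)
  -- Stay on `ω` for a long time `T` before switching to `ζ₂`. The strict gap `c₂.q < c.q`,
  -- multiplied by `T`, absorbs everything that depends on `s₁`, so the additive constant does not
  -- grow.
  obtain ⟨T, hTα, hT⟩ : ∃ T : ℝ≥0, hitTime o r β ≤ T ∧
      c₁.q * s₁ + s₁ ≤ (1 / c₂.q - 1 / c.q) * (T : ℝ) := by
    refine ⟨max (hitTime o r β) (Real.toNNReal ((c₁.q * s₁ + s₁) / (1 / c₂.q - 1 / c.q))),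
      le_max_left _ _, ?_⟩
    rw [← div_le_iff₀' hgap, NNReal.coe_max]
    exact (Real.le_coe_toNNReal _).trans (le_max_right _ _)
  obtain ⟨ζ₂, hζ₂, ha₂, s₂, u₂, he₂⟩ := h₂ (cω.q * (u₁ + T : ℝ≥0) + 1)
    (by have := cω.pos; positivity)
  have hhit : u₁ + T ≤ hitTime o (cω.q * (u₁ + T : ℝ≥0) + 1) ω := hω.le_hitTime (by linarith)
  have hjoin : ∀ v ≤ T, ζ₁ (s₁ + v) = ζ₂ (u₁ + v) := fun v hv => by
    rw [he₁, ha₂.2]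
    exact (add_le_add_right hv u₁).trans hhit
  have hη : QIOn c univ fun v => ζ₂ (u₁ + T + v) :=
    ((hζ₂.mono hq₂.le hQ₂).qiOn univ).shift _
  have hη0 : ζ₁ (s₁ + T) = (fun v => ζ₂ (u₁ + T + v)) 0 := by
    simp only [add_zero]; exact hjoin T le_rfl
  have hray : IsRay o c (glue ζ₁ (s₁ + T) fun v => ζ₂ (u₁ + T + v)) := by
    refine (QIOn.glue ((hζ₁.mono hq₁ hQ₁).qiOn _) hη hη0 fun s hs v => ?_).isRay
      (by rw [glue_of_le zero_le, hζ₁.1])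
    rcases le_total s₁ s with h | h
    · obtain ⟨w, rfl⟩ := exists_add_of_le h
      have hw := le_of_add_le_add_left hs
      rw [hjoin w hw]
      have h1 := (hζ₂.mono hq₂.le hQ₂).lower (s := u₁ + w) (t := u₁ + T + v) (by
        rw [add_assoc]; exact add_le_add_right (hw.trans (le_add_of_nonneg_right zero_le)) _)
      simp only [NNReal.coe_add] at h1 ⊢
      convert h1 using 3
      ring
    · have h1 := hζ₂.le_norm (u₁ + T + v)
      have h2 := hζ₁.norm_le s
      have h3 := dist_triangle o (ζ₁ s) (ζ₂ (u₁ + T + v))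
      have hs1 : (s : ℝ) ≤ s₁ := by exact_mod_cast h
      have h4 : c₁.q * s ≤ c₁.q * s₁ := mul_le_mul_of_nonneg_left hs1 c₁.pos.le
      have h5 : (0 : ℝ) ≤ u₁ / c₂.q := div_nonneg u₁.coe_nonneg hc₂.le
      have h6 : (0 : ℝ) ≤ s / c.q := div_nonneg s.coe_nonneg hc.le
      have h7 := QConst.div_le (c := c) s₁.coe_nonneg
      have h8 : (v : ℝ) / c.q ≤ v / c₂.q :=
        div_le_div_of_nonneg_left v.coe_nonneg hc₂ hq₂.le
      have h9 : (1 / c₂.q - 1 / c.q) * (T : ℝ) = T / c₂.q - T / c.q := by ring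
      simp only [NNReal.coe_add, add_div, sub_div] at h1 ⊢
      linarith
  refine ⟨_, hray, .of_eq hray hβ fun t ht => ?_, s₁ + T + s₂, u₂ + (u₁ + T), fun t => ?_⟩
  · rw [glue_of_le (ht.trans (hTα.trans (le_add_of_nonneg_left zero_le))), ha₁.2 t ht]
  · rw [add_assoc, glue_add hη0]
    have e : u₁ + T + (s₂ + t) = s₂ + (u₁ + T + t) := by ring
    simp only [e, he₂]
    congr 1
    ring

end Redirecting

/-! ### Redirection and convergence to the same point at infinity -/

section Asymptotic

variable {X : Type*} [MetricSpace X] {o : X}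

/-- Two paths converge to the same point at infinity. -/
def Asymptotic (o : X) (α β : ℝ≥0 → X) : Prop :=
  ∀ R : ℝ, ∃ T : ℝ≥0, ∀ s t : ℝ≥0, T ≤ s → T ≤ t → R ≤ gromovProduct o (α s) (β t)

lemma Asymptotic.symm {α β : ℝ≥0 → X} (h : Asymptotic o α β) : Asymptotic o β α := by
  intro R
  obtain ⟨T, hT⟩ := h R
  exact ⟨T, fun s t hs ht => by rw [gromovProduct_comm]; exact hT t s ht hs⟩

lemma Asymptotic.trans {δ : ℝ} (hδ : IsHyperbolicConst X δ) {α β γ : ℝ≥0 → X}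
    (h : Asymptotic o α β) (h' : Asymptotic o β γ) : Asymptotic o α γ := by
  intro R
  obtain ⟨T, hT⟩ := h (R + δ)
  obtain ⟨T', hT'⟩ := h' (R + δ)
  refine ⟨max T T', fun s t hs ht => ?_⟩
  have := hδ.le_gromovProduct (hT s (max T T') ((le_max_left _ _).trans hs) (le_max_left _ _))
    (hT' (max T T') t (le_max_right _ _) ((le_max_right _ _).trans ht))
  linarith

lemma IsRay.exists_forall_le_norm {c : QConst} {α : ℝ≥0 → X} (hα : IsRay o c α) (R : ℝ) :
    ∃ T : ℝ≥0, ∀ t ≥ T, R ≤ dist o (α t) := by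
  refine ⟨Real.toNNReal (c.q * (R + c.Q)), fun t ht => ?_⟩
  have h1 := hα.le_norm t
  have h2 : c.q * (R + c.Q) ≤ t := Real.toNNReal_le_iff_le_coe.1 ht
  have h3 : R + c.Q ≤ t / c.q := by rw [le_div_iff₀' c.pos]; exact h2
  linarith

variable [GromovHyperbolic X]

lemma IsRay.asymptotic_self (hgeo : IsGeodesicSpace X) {c : QConst} {α : ℝ≥0 → X}
    (hα : IsRay o c α) : Asymptotic o α α := by
  intro R
  obtain ⟨C, -, hC⟩ := exists_norm_sub_le_gromovProduct hgeo c
  obtain ⟨T, hT⟩ := hα.exists_forall_le_norm (R + C)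
  refine ⟨T, fun s t hs ht => ?_⟩
  rcases le_total s t with h | h
  · linarith [(hC o α hα s t h).2, hT s hs]
  · rw [gromovProduct_comm]; linarith [(hC o α hα t s h).2, hT t ht]

lemma IsRay.asymptotic_of_eventuallyCoincide (hgeo : IsGeodesicSpace X) {c : QConst}
    {α β : ℝ≥0 → X} (hα : IsRay o c α) (h : EventuallyCoincide α β) : Asymptotic o α β := by
  obtain ⟨s, u, h⟩ := h
  intro R
  obtain ⟨T, hT⟩ := hα.asymptotic_self hgeo R
  refine ⟨T + u, fun a b ha hb => ?_⟩
  obtain ⟨v, rfl⟩ := exists_add_of_le hb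
  have e : T + u + v = u + (T + v) := by ring
  rw [e, ← h]
  exact hT _ _ ((le_add_of_nonneg_right zero_le).trans ha)
    ((le_add_of_nonneg_right zero_le).trans (le_add_of_nonneg_left zero_le))

/-- A redirected ray runs towards its new direction as long as it follows the original ray. -/
lemma exists_norm_sub_le_of_redirectsAt (hgeo : IsGeodesicSpace X) (c : QConst) :
    ∃ C : ℝ, 0 ≤ C ∧ ∀ (o : X) (r : ℝ) (β α : ℝ≥0 → X), RedirectsAt o c r β α →
      ∃ T : ℝ≥0, ∀ u ≤ hitTime o r β, ∀ t ≥ T,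
        dist o (β u) - C ≤ gromovProduct o (β u) (α t) := by
  obtain ⟨C, hC0, hC⟩ := exists_norm_sub_le_gromovProduct hgeo c
  refine ⟨C, hC0, fun o r β α ⟨γ, hγ, ha, s, u', he⟩ =>
    ⟨u' + hitTime o r β, fun u hu t ht => ?_⟩⟩
  obtain ⟨v, rfl⟩ := exists_add_of_le ht
  rw [add_assoc, ← he, ← ha.2 u hu]
  exact (hC o γ hγ _ _ ((hu.trans (le_add_of_nonneg_right zero_le)).trans
    (le_add_of_nonneg_left zero_le))).2

/-- If a ray can be redirected at a large radius, then its direction is close to the new one. -/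
lemma exists_le_of_redirectsAt (hgeo : IsGeodesicSpace X) (c cβ : QConst) :
    ∃ C : ℝ, 0 ≤ C ∧ ∀ (o : X) (r : ℝ) (β α : ℝ≥0 → X), IsRay o cβ β → RedirectsAt o c r β α →
      ∃ T : ℝ≥0, ∀ s ≥ hitTime o r β, ∀ t ≥ T, r - C ≤ gromovProduct o (β s) (α t) := by
  obtain ⟨δ, hδ⟩ := exists_isHyperbolicConst X
  obtain ⟨C, hC0, hC⟩ := exists_norm_sub_le_of_redirectsAt hgeo c
  obtain ⟨C', hC0', hC'⟩ := exists_norm_sub_le_gromovProduct hgeo cβ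
  refine ⟨C + C' + δ, by linarith [hδ.1], fun o r β α hβ h => ?_⟩
  obtain ⟨T, hT⟩ := hC o r β α h
  -- Compare both points with the exit point of `β`: stability of `β` handles `β s`, that of the
  -- redirected ray handles `α t`.
  refine ⟨T, fun s hs t ht => ?_⟩
  have h1 := hT _ le_rfl t ht
  have h2 := (hC' o β hβ _ s hs).2
  have h3 := hβ.le_norm_hitTime r
  rw [gromovProduct_comm] at h2
  have := hδ.le_gromovProduct (K := r - C - C') (by linarith) (h1.trans' (by linarith))
  linarith

lemma asymptotic_of_redirectsAt (hgeo : IsGeodesicSpace X) {c cβ : QConst} {β α : ℝ≥0 → X}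
    (hβ : IsRay o cβ β) (h : ∀ r : ℝ, 0 < r → RedirectsAt o c r β α) : Asymptotic o β α := by
  obtain ⟨C, hC0, hC⟩ := exists_le_of_redirectsAt hgeo c cβ
  intro R
  obtain ⟨T, hT⟩ := hC o (max 0 (R + C) + 1) β α hβ (h _ (by positivity))
  refine ⟨max (hitTime o (max 0 (R + C) + 1) β) T, fun s t hs ht => ?_⟩
  have := hT s ((le_max_left _ _).trans hs) t ((le_max_right _ _).trans ht)
  linarith [le_max_right 0 (R + C)]

/-- A quasi-geodesic ray can be redirected to any asymptotic geodesic ray. -/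
lemma redirectsAt_of_asymptotic_geodesic (hgeo : IsGeodesicSpace X) {c c' : QConst}
    {β ω : ℝ≥0 → X} (hβ : IsRay o c β) (hω : IsRay o .geodesic ω) (h : Asymptotic o β ω)
    (hq : c.q < c'.q) (hQ : c.Q ≤ c'.Q) (hQ1 : 1 ≤ c'.Q) (r : ℝ) : RedirectsAt o c' r β ω := by
  obtain ⟨δ, hδ⟩ := exists_isHyperbolicConst X
  obtain ⟨C, hC0, hC⟩ := exists_norm_sub_le_gromovProduct hgeo c
  have hgap : 0 < 1 / c.q - 1 / c'.q := sub_pos.2 (one_div_lt_one_div_of_lt c.pos hq)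
  -- Far out, the distance from `β S` to `ω T`, less `T`, is at most `-‖β S‖ + 2 * C + 2 * δ`, and
  -- `‖β S‖ ≥ S / c.q - c.Q`. This `S` lets the gap between `c.q` and `c'.q` beat the constants.
  let S : ℝ≥0 := Real.toNNReal ((c.Q + 2 * C + 2 * δ + r + 2) / (1 / c.q - 1 / c'.q))
  have hS : c.Q + 2 * C + 2 * δ + r + 2 ≤ S / c.q - S / c'.q := by
    have h1 : (c.Q + 2 * C + 2 * δ + r + 2) / (1 / c.q - 1 / c'.q) ≤ S := Real.le_coe_toNNReal _
    rw [div_le_iff₀ hgap] at h1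
    have h2 : (S : ℝ) * (1 / c.q - 1 / c'.q) = S / c.q - S / c'.q := by ring
    linarith
  obtain ⟨T, hT⟩ := h (dist o (β S))
  have h1 := (hC o β hβ S (max S T) (le_max_left _ _)).2
  have h2 := hδ.le_gromovProduct h1
    ((hT (max S T) T (le_max_right _ _) le_rfl).trans' (by linarith))
  have h3 := hβ.le_norm S
  refine redirectsAt_geodesic hgeo hβ hω hq.le hQ hQ1 (S := S) (P := T) ?_
  unfold gromovProduct at h2
  rw [hω.norm_geodesic] at h2
  linarith

/-- A geodesic ray can be redirected to any asymptotic quasi-geodesic ray. -/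
lemma exists_redirectsAt_of_geodesic (hgeo : IsGeodesicSpace X) {c : QConst}
    {β ω : ℝ≥0 → X} (hβ : IsRay o c β) (hω : IsRay o .geodesic ω) (h : Asymptotic o ω β) :
    ∃ c' : QConst, ∀ r : ℝ, RedirectsAt o c' r ω β := by
  obtain ⟨δ, hδ⟩ := exists_isHyperbolicConst X
  obtain ⟨C, hC0, hC⟩ := exists_norm_sub_le_gromovProduct hgeo c
  have hδ0 := hδ.1
  set E := 2 * C + 4 * δ with hE
  have hE0 : 0 ≤ E := by positivity
  let c' : QConst := ⟨c.q, c.Q + 2 * C + 2 * E, c.one_le, by have := c.nonneg; positivity⟩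
  refine ⟨c', fun r => ?_⟩
  have hcQ := c.nonneg
  set p := hitTime o r β
  set T := nndist o (β p) with hT
  have hTn : (T : ℝ) = dist o (β p) := rfl
  have hrT : r ≤ dist o (ω T) := by
    rw [hω.norm_geodesic, hTn]; exact hβ.le_norm_hitTime r
  -- Points of asymptotic rays at the same distance from `o` are uniformly close; so one may follow
  -- `ω`, cross a segment of length at most `E`, and continue along `β`.
  have hclose : dist (ω T) (β p) ≤ E := by
    obtain ⟨T', hT'⟩ := h T
    set t := max T' (max T p)
    have h1 := hT' t t (le_max_left _ _) (le_max_left _ _)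
    have h2 : gromovProduct o (ω T) (ω t) = T := by
      have hle : T ≤ t := (le_max_left _ _).trans (le_max_right _ _)
      unfold gromovProduct
      rw [hω.norm_geodesic, hω.norm_geodesic, hω.dist_geodesic hle]
      ring
    have h3 := (hC o β hβ p t ((le_max_right _ _).trans (le_max_right _ _))).2
    rw [gromovProduct_comm] at h3
    have h4 := hδ.le_gromovProduct h2.ge h1
    have h5 := hδ.le_gromovProduct (K := T - C - δ) (h4.trans' (by linarith))
      (h3.trans' (by linarith))
    unfold gromovProduct at h5
    rw [hω.norm_geodesic] at h5
    linarith
  have hβ' : IsRay o c' β := hβ.mono le_rfl (by change c.Q ≤ c.Q + 2 * C + 2 * E; linarith)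
  obtain ⟨ζ, hζ0, hζ, hζβ, hζd⟩ := exists_prepend_segment hgeo (c := c') (ω T)
    (η := fun v => β (p + v)) ((hβ'.qiOn univ).shift p) fun z v hz => by
      simp only [add_zero] at hz ⊢
      have h1 := hβ.lower (le_add_of_nonneg_right (zero_le (a := v)) : p ≤ p + v)
      have h2 := dist_triangle_left (β p) (β (p + v)) z
      have h3 := QConst.div_le (c := c) (dist_nonneg (x := z) (y := β p))
      rw [NNReal.coe_add, add_sub_cancel_left] at h1
      change (dist z (β p) + v) / c.q - (c.Q + 2 * C + 2 * E) ≤ _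
      rw [add_div]
      linarith [dist_nonneg (x := ω T) (y := z)]
  simp only [add_zero] at hζβ hζd
  have hζ0' : ω T = ζ 0 := hζ0.symm
  have hray : IsRay o c' (glue ω T ζ) := by
    refine (QIOn.glue ((hω.of_geodesic c').qiOn _) hζ hζ0' fun s hs v => ?_).isRay
      (by rw [glue_of_le zero_le, hω.1])
    have hsT : (s : ℝ) ≤ T := by exact_mod_cast hs
    have h0 := QConst.div_le (c := c) (sub_nonneg.2 hsT)
    change ((T : ℝ) - s + v) / c.q - (c.Q + 2 * C + 2 * E) ≤ _
    rcases le_total v (nndist (ω T) (β p)) with hv | hv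
    · have h1 := dist_triangle_right (ω s) (ω T) (ζ v)
      rw [hω.dist_geodesic hs, (hζd v hv).1] at h1
      have h2 : (v : ℝ) ≤ E := le_trans (by exact_mod_cast hv) hclose
      have h3 := QConst.div_le (c := c) v.coe_nonneg
      rw [add_div]
      linarith
    -- By stability `‖β (p + w)‖` exceeds `‖β p‖` by the distance between these points, up to `2 *
    -- C`; subtracting `‖ω s‖ = s` gives the bound.
    · obtain ⟨w, rfl⟩ := exists_add_of_le hv
      have h1 := hβ.lower (le_add_of_nonneg_right (zero_le (a := w)) : p ≤ p + w)
      have h2 := (hC o β hβ p (p + w) (le_add_of_nonneg_right zero_le)).1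
      have h3 := dist_triangle o (ω s) (β (p + w))
      have h4 := QConst.div_le (c := c) (dist_nonneg (x := ω T) (y := β p))
      unfold gromovProduct at h2
      rw [dist_comm (β p) o] at h2
      rw [hω.norm_geodesic] at h3
      rw [NNReal.coe_add, add_sub_cancel_left] at h1
      have h5 : ((nndist (ω T) (β p) : ℝ≥0) : ℝ) = dist (ω T) (β p) := rfl
      rw [hζβ, NNReal.coe_add, h5, add_div, add_div]
      linarith
  refine ⟨glue ω T ζ, hray, .of_eq hray hω fun t ht => glue_of_le (ht.trans (hitTime_le hrT)),
    T + nndist (ω T) (β p), p, fun t => ?_⟩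
  rw [add_assoc, glue_add hζ0', hζβ]

end Asymptotic

/-! ### Rays and the Gromov boundary -/

section Boundary

variable {X : Type*} [MetricSpace X] {o : X}

lemma tendsto_prod_nat_atTop_iff {f : ℕ × ℕ → ℝ} :
    Tendsto f atTop atTop ↔ ∀ R : ℝ, ∃ N : ℕ, ∀ i j : ℕ, N ≤ i → N ≤ j → R ≤ f (i, j) := by
  rw [tendsto_atTop]
  refine forall_congr' fun R => ?_
  rw [eventually_atTop]
  constructor
  · rintro ⟨⟨a, b⟩, h⟩
    exact ⟨max a b, fun i j hi hj =>
      h (i, j) ⟨(le_max_left _ _).trans hi, (le_max_right _ _).trans hj⟩⟩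
  · rintro ⟨N, h⟩
    exact ⟨(N, N), fun p hp => h p.1 p.2 hp.1 hp.2⟩

lemma Asymptotic.tendsto {α β : ℝ≥0 → X} (h : Asymptotic o α β) :
    Tendsto (fun p : ℕ × ℕ => gromovProduct o (α p.1) (β p.2)) atTop atTop := by
  rw [tendsto_prod_nat_atTop_iff]
  intro R
  obtain ⟨T, hT⟩ := h R
  obtain ⟨N, hN⟩ := exists_nat_ge T
  exact ⟨N, fun i j hi hj => hT i j (hN.trans (by exact_mod_cast hi))
    (hN.trans (by exact_mod_cast hj))⟩

lemma GromovSeq.tendsto_norm (x : GromovSeq o) : Tendsto (fun n => dist o (x.1 n)) atTop atTop := by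
  rw [tendsto_atTop]
  intro R
  obtain ⟨N, hN⟩ := tendsto_prod_nat_atTop_iff.1 x.2 R
  filter_upwards [eventually_ge_atTop N] with n hn
  exact (hN n n hn hn).trans (gromovProduct_le_dist _ _ _)

lemma QRay.exists_direction_eq (a : Directions o) : ∃ α : QRay o, α.direction = a :=
  Quotient.exists_rep a

variable [GromovHyperbolic X]

/-- Integer times suffice: late points of one quasi-geodesic ray have large Gromov products with one
another. -/
lemma asymptotic_of_tendsto (hgeo : IsGeodesicSpace X) {c c' : QConst} {α β : ℝ≥0 → X}
    (hα : IsRay o c α) (hβ : IsRay o c' β)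
    (h : Tendsto (fun p : ℕ × ℕ => gromovProduct o (α p.1) (β p.2)) atTop atTop) :
    Asymptotic o α β := by
  obtain ⟨δ, hδ⟩ := exists_isHyperbolicConst X
  rw [tendsto_prod_nat_atTop_iff] at h
  intro R
  obtain ⟨N, hN⟩ := h (R + 2 * δ)
  obtain ⟨T, hT⟩ := hα.asymptotic_self hgeo (R + 2 * δ)
  obtain ⟨T', hT'⟩ := hβ.asymptotic_self hgeo (R + 2 * δ)
  obtain ⟨M, hM⟩ := exists_nat_ge (max T T')
  set n := max N M
  have hn : max T T' ≤ (n : ℝ≥0) := hM.trans (by exact_mod_cast le_max_right _ _)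
  refine ⟨max T T', fun s t hs ht => ?_⟩
  have h1 := hT s n ((le_max_left _ _).trans hs) ((le_max_left _ _).trans hn)
  have h2 := hN n n (le_max_left _ _) (le_max_left _ _)
  have h3 := hT' n t ((le_max_right _ _).trans hn) ((le_max_right _ _).trans ht)
  have h4 := hδ.le_gromovProduct h1 h2
  have h5 := hδ.le_gromovProduct h4 (h3.trans' (by linarith [hδ.1]))
  linarith

/-- The sequence of points of a quasi-geodesic ray at integer times. -/
def QRay.seq (hgeo : IsGeodesicSpace X) (α : QRay o) : GromovSeq o :=
  ⟨fun n => α.1 n, by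
    obtain ⟨c, hc⟩ := α.2
    exact (hc.asymptotic_self hgeo).tendsto⟩

lemma GromovSeq.limit_eq_iff {x y : GromovSeq o} : x.limit = y.limit ↔
    Tendsto (fun p : ℕ × ℕ => gromovProduct o (x.1 p.1) (y.1 p.2)) atTop atTop :=
  Quotient.eq (r := gromovSetoid o)

lemma QRay.limit_seq_eq_iff (hgeo : IsGeodesicSpace X) {α β : QRay o} :
    (α.seq hgeo).limit = (β.seq hgeo).limit ↔ Asymptotic o α.1 β.1 := by
  obtain ⟨c, hc⟩ := α.2
  obtain ⟨c', hc'⟩ := β.2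
  rw [GromovSeq.limit_eq_iff]
  exact ⟨asymptotic_of_tendsto hgeo hc hc', Asymptotic.tendsto⟩

/-- Every point of the Gromov boundary is the endpoint of a geodesic ray. -/
lemma exists_geodesic_ray [ProperSpace X] (hgeo : IsGeodesicSpace X) (x : GromovSeq o) :
    ∃ ω : ℝ≥0 → X, IsRay o .geodesic ω ∧
      Tendsto (fun p : ℕ × ℕ => gromovProduct o (ω p.1) (x.1 p.2)) atTop atTop := by
  obtain ⟨δ, hδ⟩ := exists_isHyperbolicConst X
  choose g hg0 hg1 hg using fun n => hgeo o (x.1 n)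
  let F : ℕ → ℝ≥0 → X := fun n t => g n (min t (dist o (x.1 n)))
  have hmem : ∀ n (t : ℝ≥0), min (t : ℝ) (dist o (x.1 n)) ∈ Icc 0 (dist o (x.1 n)) := fun n t =>
    ⟨le_min t.coe_nonneg dist_nonneg, min_le_right _ _⟩
  have hball : ∀ n (t : ℝ≥0), F n t ∈ Metric.closedBall o t := fun n t => by
    rw [Metric.mem_closedBall, dist_comm, ← hg0 n, hg n 0 ⟨le_rfl, dist_nonneg⟩ _ (hmem n t),
      zero_sub, abs_neg, abs_of_nonneg (hmem n t).1]
    exact min_le_left _ _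
  -- The geodesics to `x n`, stopped at their ends, have pointwise limits along an ultrafilter
  -- because closed balls are compact. This replaces a diagonal extraction.
  let 𝒰 : Ultrafilter ℕ := hyperfilter ℕ
  have h𝒰 : (𝒰 : Filter ℕ) ≤ atTop := Nat.hyperfilter_le_atTop
  have hlim : ∀ t : ℝ≥0, ∃ y, Tendsto (fun n => F n t) 𝒰 (𝓝 y) := fun t => by
    obtain ⟨y, -, hy⟩ := (isCompact_closedBall o (t : ℝ)).ultrafilter_le_nhds
      (𝒰.map fun n => F n t) (by
        rw [le_principal_iff]
        exact Eventually.of_forall (f := (𝒰 : Filter ℕ)) fun n => hball n t)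
    exact ⟨y, hy⟩
  choose ω hω using hlim
  have hlarge : ∀ t : ℝ≥0, ∀ᶠ n in (𝒰 : Filter ℕ), min (t : ℝ) (dist o (x.1 n)) = t := fun t => by
    filter_upwards [h𝒰 (x.tendsto_norm.eventually_ge_atTop (t : ℝ))] with n hn
    exact min_eq_left hn
  have hdist : ∀ s t : ℝ≥0, dist (ω s) (ω t) = dist s t := fun s t => by
    refine tendsto_nhds_unique ((hω s).dist (hω t)) (tendsto_const_nhds.congr' ?_)
    filter_upwards [hlarge s, hlarge t] with n hs ht
    rw [hg n _ (hmem n s) _ (hmem n t), hs, ht, NNReal.dist_eq]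
  have hω0 : ω 0 = o := by
    refine tendsto_nhds_unique (hω 0) (tendsto_const_nhds.congr fun n => ?_)
    change o = g n (min ((0 : ℝ≥0) : ℝ) (dist o (x.1 n)))
    rw [NNReal.coe_zero, min_eq_left dist_nonneg, hg0]
  have hray : IsRay o .geodesic ω := ⟨hω0, fun s t => by
    rw [hdist, QConst.geodesic_q, QConst.geodesic_Q]; simp⟩
  refine ⟨ω, hray, ?_⟩
  -- The point at time `t` on the geodesic to `x n` has Gromov product exactly `t` with `x n`, and
  -- `ω t` is within `1` of it for `𝒰`-many `n`.
  have hprod : ∀ t : ℝ≥0, ∀ᶠ n in (𝒰 : Filter ℕ), (t : ℝ) - 1 ≤ gromovProduct o (ω t) (x.1 n) := by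
    intro t
    filter_upwards [hlarge t, (Metric.tendsto_nhds.1 (hω t)) 1 one_pos] with n hn hn1
    have h1 := gromovProduct_le_add o (F n t) (ω t) (x.1 n)
    have h2 : gromovProduct o (F n t) (x.1 n) = t := by
      have h3 := hg n 0 ⟨le_rfl, dist_nonneg⟩ _ (hmem n t)
      have h4 := hg n _ (hmem n t) (dist o (x.1 n)) ⟨dist_nonneg, le_rfl⟩
      rw [hg0, zero_sub, abs_neg, abs_of_nonneg (hmem n t).1] at h3
      rw [hg1, abs_sub_comm, abs_of_nonneg (sub_nonneg.2 (hmem n t).2)] at h4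
      unfold gromovProduct
      change (dist o (g n _) + _ - dist (g n _) _) / 2 = _
      rw [h3, h4, hn]
      ring
    linarith
  rw [tendsto_prod_nat_atTop_iff]
  intro R
  obtain ⟨N, hN⟩ := tendsto_prod_nat_atTop_iff.1 x.2 (R + 2 * δ)
  obtain ⟨M, hM⟩ := exists_nat_ge (R + 2 * δ + 1)
  refine ⟨max N M, fun i j hi hj => ?_⟩
  have hi' : (M : ℝ) ≤ i := by exact_mod_cast (le_max_right _ _).trans hi
  obtain ⟨n, hn, hnN⟩ := ((hprod i).and (h𝒰 (eventually_ge_atTop N))).exists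
  have h1 := hN n j hnN ((le_max_left _ _).trans hj)
  rw [NNReal.coe_natCast] at hn
  have := hδ.le_gromovProduct (hn.trans' (by linarith)) h1
  change R ≤ gromovProduct o (ω i) (x.1 j)
  linarith [hδ.1]

end Boundary

/-! ### Directions are the points of the Gromov boundary -/

section Directions

variable {X : Type*} [MetricSpace X] [GromovHyperbolic X] {o : X}

lemma QRay.asymptotic_of_le (hgeo : IsGeodesicSpace X) {α β : QRay o} (h : α ≤ β) :
    Asymptotic o α.1 β.1 := by
  obtain ⟨c, hc⟩ := α.2
  obtain ⟨c', h⟩ := h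
  exact asymptotic_of_redirectsAt hgeo hc h

lemma exists_geodesic_asymptotic [ProperSpace X] (hgeo : IsGeodesicSpace X) (ξ : GromovBoundary o) :
    ∃ ω : QRay o, IsRay o .geodesic ω.1 ∧ (ω.seq hgeo).limit = ξ := by
  obtain ⟨x, rfl⟩ := Quotient.exists_rep ξ
  obtain ⟨ω, hω, h⟩ := exists_geodesic_ray hgeo x
  exact ⟨⟨ω, _, hω⟩, hω, GromovSeq.limit_eq_iff.2 h⟩

/-- A ray is redirectable to another one if and only if they have the same endpoint. -/
lemma QRay.le_iff [ProperSpace X] (hgeo : IsGeodesicSpace X) {α β : QRay o} :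
    α ≤ β ↔ Asymptotic o α.1 β.1 := by
  refine ⟨QRay.asymptotic_of_le hgeo, fun h => ?_⟩
  obtain ⟨δ, hδ⟩ := exists_isHyperbolicConst X
  obtain ⟨ω, hω, hlim⟩ := exists_geodesic_asymptotic hgeo (α.seq hgeo).limit
  have hωα := (QRay.limit_seq_eq_iff hgeo).1 hlim
  obtain ⟨c, hc⟩ := α.2
  obtain ⟨c', hc'⟩ := β.2
  have h1 : α ≤ ω := ⟨⟨c.q + 1, max c.Q 1, by linarith [c.one_le], le_max_of_le_left c.nonneg⟩,
    fun r _ => redirectsAt_of_asymptotic_geodesic hgeo hc hω hωα.symm (lt_add_one _)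
      (le_max_left _ _) (le_max_right _ _) r⟩
  obtain ⟨c'', hc''⟩ := exists_redirectsAt_of_geodesic hgeo hc' hω (hωα.trans hδ h)
  exact h1.trans ⟨c'', fun r _ => hc'' r⟩

/-- The endpoint of a direction. -/
def endpoint (hgeo : IsGeodesicSpace X) : Directions o → GromovBoundary o :=
  Quotient.lift (fun α : QRay o => (α.seq hgeo).limit) fun _ _ h =>
    (QRay.limit_seq_eq_iff hgeo).2 (QRay.asymptotic_of_le hgeo h.1)

lemma endpoint_direction (hgeo : IsGeodesicSpace X) (α : QRay o) :
    endpoint hgeo α.direction = (α.seq hgeo).limit := rfl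

lemma endpoint_bijective [ProperSpace X] (hgeo : IsGeodesicSpace X) :
    Function.Bijective (endpoint (o := o) hgeo) := by
  refine ⟨fun a b h => ?_, fun ξ => ?_⟩
  · obtain ⟨α, rfl⟩ := QRay.exists_direction_eq a
    obtain ⟨β, rfl⟩ := QRay.exists_direction_eq b
    have := (QRay.limit_seq_eq_iff hgeo).1 h
    exact Quotient.sound ⟨(QRay.le_iff hgeo).2 this, (QRay.le_iff hgeo).2 this.symm⟩
  · obtain ⟨ω, -, h⟩ := exists_geodesic_asymptotic hgeo ξ
    exact ⟨ω.direction, h⟩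

/-- Geodesic rays as central elements. -/
lemma nonempty_redirectingData [ProperSpace X] (hgeo : IsGeodesicSpace X) :
    Nonempty (RedirectingData o) := by
  choose ω hω hlim using fun a : Directions o => exists_geodesic_asymptotic hgeo (endpoint hgeo a)
  have hdir : ∀ a, (ω a).direction = a := fun a => (endpoint_bijective hgeo).1 (hlim a)
  refine ⟨⟨.geodesic, ω, hdir, hω,
    fun _ c => ⟨c.q + 1, max c.Q 1, by linarith [c.one_le], le_max_of_le_left c.nonneg⟩, ?_⟩⟩
  rintro a _ hba c β rfl hβ r -
  have hle : β.direction ≤ (ω a).direction := by rwa [hdir a]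
  exact redirectsAt_of_asymptotic_geodesic hgeo hβ (hω a) (QRay.asymptotic_of_le hgeo hle)
    (lt_add_one _) (le_max_left _ _) (le_max_right _ _) r

end Directions

/-! ### Neighbourhoods in the Gromov compactification, seen from rays -/

section Compactification

variable {X : Type*} [MetricSpace X] [GromovHyperbolic X] {o : X}

/-- Allows the unspecified sequences in the definition of `N` to be replaced by rays, at the cost of
one `δ` for each replacement. -/
lemma QRay.exists_le_of_limit_eq (hgeo : IsGeodesicSpace X) {α : QRay o} {x : GromovSeq o}
    (h : x.limit = (α.seq hgeo).limit) (R : ℝ) :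
    ∃ (T : ℝ≥0) (N : ℕ), ∀ t ≥ T, ∀ i ≥ N, R ≤ gromovProduct o (α.1 t) (x.1 i) := by
  obtain ⟨δ, hδ⟩ := exists_isHyperbolicConst X
  obtain ⟨c, hc⟩ := α.2
  obtain ⟨T, hT⟩ := hc.asymptotic_self hgeo (R + δ)
  obtain ⟨N, hN⟩ := tendsto_prod_nat_atTop_iff.1 (GromovSeq.limit_eq_iff.1 h.symm) (R + δ)
  obtain ⟨M, hM⟩ := exists_nat_ge T
  refine ⟨T, N, fun t ht i hi => ?_⟩
  have h1 := hT t (max N M : ℕ) ht (hM.trans (by exact_mod_cast le_max_right _ _))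
  have h2 := hN (max N M) i (le_max_left _ _) hi
  have := hδ.le_gromovProduct h1 h2
  linarith

namespace GromovCompactification

lemma ofPoint_mem_N (hgeo : IsGeodesicSpace X) {α : QRay o} {y : X} {R : ℝ} {T : ℝ≥0}
    (h : ∀ t ≥ T, R ≤ gromovProduct o (α.1 t) y) : ofPoint y ∈ N (α.seq hgeo).limit R := by
  obtain ⟨M, hM⟩ := exists_nat_ge T
  refine ⟨α.seq hgeo, rfl, ?_⟩
  change ∀ᶠ i in atTop, _
  filter_upwards [eventually_ge_atTop M] with i hi
  exact h i (hM.trans (by exact_mod_cast hi))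

lemma ofBoundary_mem_N (hgeo : IsGeodesicSpace X) {α β : QRay o} {R : ℝ} {T : ℝ≥0}
    (h : ∀ s ≥ T, ∀ t ≥ T, R ≤ gromovProduct o (α.1 s) (β.1 t)) :
    ofBoundary (β.seq hgeo).limit ∈ N (α.seq hgeo).limit R := by
  obtain ⟨M, hM⟩ := exists_nat_ge T
  refine ⟨α.seq hgeo, rfl, β.seq hgeo, rfl, ?_⟩
  filter_upwards [eventually_ge_atTop (M, M)] with q hq
  exact h q.1 (hM.trans (by exact_mod_cast hq.1)) q.2 (hM.trans (by exact_mod_cast hq.2))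

lemma exists_of_ofPoint_mem_N (hgeo : IsGeodesicSpace X) {δ : ℝ} (hδ : IsHyperbolicConst X δ)
    {α : QRay o} {y : X} {R : ℝ} (h : ofPoint y ∈ N (α.seq hgeo).limit R) :
    ∃ T : ℝ≥0, ∀ t ≥ T, R - δ ≤ gromovProduct o (α.1 t) y := by
  obtain ⟨x, hx, hy⟩ := h
  change ∀ᶠ i in atTop, R ≤ gromovProduct o (x.1 i) y at hy
  obtain ⟨T, N, hT⟩ := QRay.exists_le_of_limit_eq hgeo hx R
  obtain ⟨i, hi, hi'⟩ := (hy.and (eventually_ge_atTop N)).exists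
  exact ⟨T, fun t ht => hδ.le_gromovProduct (hT t ht i hi') hi⟩

lemma exists_of_ofBoundary_mem_N (hgeo : IsGeodesicSpace X) {δ : ℝ} (hδ : IsHyperbolicConst X δ)
    {α β : QRay o} {R : ℝ} (h : ofBoundary (β.seq hgeo).limit ∈ N (α.seq hgeo).limit R) :
    ∃ T : ℝ≥0, ∀ s ≥ T, ∀ t ≥ T, R - 2 * δ ≤ gromovProduct o (α.1 s) (β.1 t) := by
  obtain ⟨x, hx, y, hy, hxy⟩ := h
  obtain ⟨T, N, hT⟩ := QRay.exists_le_of_limit_eq hgeo hx R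
  obtain ⟨T', N', hT'⟩ := QRay.exists_le_of_limit_eq hgeo hy R
  obtain ⟨q, hq, hq'⟩ := (hxy.and (eventually_ge_atTop (N, N'))).exists
  refine ⟨max T T', fun s hs t ht => ?_⟩
  have h1 := hT s ((le_max_left _ _).trans hs) q.1 hq'.1
  have h2 := hT' t ((le_max_right _ _).trans ht) q.2 hq'.2
  rw [gromovProduct_comm] at h2
  have h3 := hδ.le_gromovProduct h1 hq
  have h4 := hδ.le_gromovProduct h3 (h2.trans' (by linarith [hδ.1]))
  linarith

end GromovCompactification

end Compactification

namespace RedirectingData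

variable {X : Type*} [MetricSpace X] {o : X} (D : RedirectingData o)

lemma mem_nbhd_ofPoint {x : X} {V : Set D.Bordification} :
    V ∈ D.nbhd (Sum.inl x) ↔ ∃ r : ℝ, 0 < r ∧ D.ofPoint '' Metric.ball x r ⊆ V := Iff.rfl

lemma mem_nbhd_ofDirection {a : Directions o} {V : Set D.Bordification} :
    V ∈ D.nbhd (Sum.inr a) ↔ ∃ r : ℝ, 0 < r ∧ D.U a r ⊆ V := Iff.rfl

end RedirectingData

/-! ### Comparison of the two neighbourhood systems -/

section Bordification

open GromovCompactification

variable {X : Type*} [MetricSpace X] [GromovHyperbolic X] {o : X}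

/-- If a quasi-geodesic ray passes close to the endpoint of a geodesic ray, then it can be
redirected to that ray, whatever its constants. -/
lemma exists_redirectsAt_of_le_gromovProduct (hgeo : IsGeodesicSpace X) {ω : ℝ≥0 → X}
    (hω : IsRay o .geodesic ω) {r : ℝ} (hr : 0 < r) :
    ∃ R : ℝ, ∀ c c' : QConst, c'.q = c.q + 1 → c'.Q = c.q + c.Q → ∀ β : ℝ≥0 → X, IsRay o c β →
      (∃ t P : ℝ≥0, R ≤ gromovProduct o (β t) (ω P)) → RedirectsAt o c' r β ω := by
  obtain ⟨δ, hδ⟩ := exists_isHyperbolicConst X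
  have hδ0 := hδ.1
  -- When returning to `o` is too costly, `c.q + c.Q / (c.q + 1) < 2 * r`, which bounds `c` by `b`.
  -- The stability constant of `b` then serves all such `c`.
  let b : QConst := ⟨2 * r + 1, 2 * r * (2 * r + 1), by linarith, by positivity⟩
  have hbq : b.q = 2 * r + 1 := rfl
  have hbQ : b.Q = 2 * r * (2 * r + 1) := rfl
  obtain ⟨C, hC0, hC⟩ := exists_norm_sub_le_gromovProduct hgeo b
  have hb0 := b.pos
  have hb1 := b.nonneg
  set R := (b.q + 1) * (b.Q + 2 * C + 2 * δ + r + 2) with hR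
  have hR0 : 0 ≤ R := by positivity
  refine ⟨R, fun c c' hq hQ β hβ ⟨t, P, htP⟩ => ?_⟩
  have hc := c.one_le
  have hcQ := c.nonneg
  by_cases hcase : 2 * r ≤ c.q + c.Q / (c.q + 1)
  · exact redirectsAt_geodesic_of_le hgeo hβ hω hq hQ hr hcase
  have hc1 : 0 < c.q + 1 := by linarith
  have hfrac : 0 ≤ c.Q / (c.q + 1) := by positivity
  have hcq : c.q ≤ 2 * r := by linarith
  have hQle : c.Q ≤ b.Q := by
    have h1 : c.Q / (c.q + 1) ≤ 2 * r := by linarith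
    rw [div_le_iff₀ hc1] at h1
    exact h1.trans (by rw [hbQ]; gcongr)
  have hβb : IsRay o b β := hβ.mono (by linarith) hQle
  set S := hitTime o R β with hS
  have hSn : dist o (β S) = R := hβ.norm_hitTime hR0
  have hSt : S ≤ t := hitTime_le (htP.trans (gromovProduct_le_dist _ _ _))
  have hSle : (S : ℝ) ≤ c.q * (R + c.Q) := hβ.hitTime_le_mul hR0
  have h1 := (hC o β hβb S t hSt).2
  have h2 := hδ.le_gromovProduct h1 (htP.trans' (by linarith))
  refine redirectsAt_geodesic hgeo hβ hω (by linarith) (by linarith) (by linarith)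
    (S := S) (P := P) ?_
  -- The exit time satisfies `S ≤ c.q * (R + c.Q)`; dividing by `c.q + 1` instead of `c.q` gains `R
  -- / (c.q + 1)`, and `R` was chosen so that this gain outweighs the constants.
  have h3 : (S : ℝ) / c'.q ≤ R - R / (b.q + 1) + b.Q := by
    have h4 : R / (b.q + 1) ≤ R / (c.q + 1) :=
      div_le_div_of_nonneg_left hR0 hc1 (by linarith)
    have h5 : (S : ℝ) / (c.q + 1) ≤ R - R / (c.q + 1) + c.Q := by
      rw [div_le_iff₀ hc1, add_mul, sub_mul, div_mul_cancel₀ _ hc1.ne']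
      linarith
    rw [hq]
    linarith
  have h4 : R / (b.q + 1) = b.Q + 2 * C + 2 * δ + r + 2 := by
    rw [hR]; field_simp
  rw [hSn] at h2
  unfold gromovProduct at h2
  rw [hω.norm_geodesic, hSn] at h2
  linarith

namespace RedirectingData

variable (D : RedirectingData o)

lemma endpoint_eq (hgeo : IsGeodesicSpace X) (a : Directions o) :
    endpoint hgeo a = ((D.central a).seq hgeo).limit := by
  rw [← endpoint_direction, D.central_mem]

variable [ProperSpace X]

/-- A geodesic ray run at speed `c.q` is a `c`-ray, and a ray that agrees with it up to radius `1`
cannot have a smaller Lipschitz constant. Hence `F a c` has room for the intermediate constant `c.q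
+ 1` in `exists_mem_U`. -/
lemma le_f_q (hgeo : IsGeodesicSpace X) (a : Directions o) (c : QConst) : c.q ≤ (D.f a c).q := by
  obtain ⟨ω, hω, hlim⟩ := exists_geodesic_asymptotic hgeo (endpoint hgeo a)
  have hq := c.pos
  let q : ℝ≥0 := ⟨c.q, hq.le⟩
  let β : ℝ≥0 → X := fun t => ω.1 (q * t)
  have hβd : ∀ s t : ℝ≥0, s ≤ t → dist (β s) (β t) = c.q * (t - s) := fun s t hst => by
    change dist (ω.1 _) (ω.1 _) = _
    rw [hω.dist_geodesic (mul_le_mul_right hst q), NNReal.coe_mul, NNReal.coe_mul]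
    change c.q * t - c.q * s = _
    ring
  have hβ : IsRay o c β := by
    refine QIOn.isRay (fun s _ t _ hst => ?_) (by change ω.1 _ = o; rw [mul_zero, hω.1])
    have h1 : (0 : ℝ) ≤ t - s := sub_nonneg.2 (by exact_mod_cast hst)
    rw [hβd s t hst]
    have h2 := QConst.div_le (c := c) h1
    have h3 := mul_le_mul_of_nonneg_right c.one_le h1
    exact ⟨by linarith [c.nonneg], le_rfl⟩
  let β' : QRay o := ⟨β, c, hβ⟩
  have hdir : β'.direction = a := by
    apply (endpoint_bijective hgeo).1
    rw [← hlim, endpoint_direction, QRay.limit_seq_eq_iff]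
    intro R
    obtain ⟨T, hT⟩ := hω.asymptotic_self hgeo R
    refine ⟨T, fun s t hs ht => hT _ _ (hs.trans ?_) ht⟩
    exact le_mul_of_one_le_left zero_le (by exact_mod_cast c.one_le)
  obtain ⟨γ, hγ, hag, -⟩ := D.redirects a a le_rfl c β' hdir hβ 1 one_pos
  have h1 := hγ.upper (zero_le (a := hitTime o 1 β))
  have h2 := hβd 0 (hitTime o 1 β) zero_le
  rw [hγ.1, hag.2 _ le_rfl] at h1
  change dist o (β _) ≤ _ at h1
  rw [hβ.1] at h2
  rw [h2] at h1
  rw [hβ.norm_hitTime zero_le_one] at h2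
  have h3 : (0 : ℝ) < hitTime o 1 β - (0 : ℝ≥0) := by
    by_contra hcon
    have := mul_nonneg hq.le (neg_nonneg.2 (not_lt.1 hcon))
    linarith
  exact le_of_mul_le_mul_right h1 h3

/-- The comparison of `X ∪ P(X)` with the Gromov compactification. -/
noncomputable def toCompactification (hgeo : IsGeodesicSpace X) :
    D.Bordification ≃ GromovCompactification o :=
  Equiv.sumCongr (Equiv.refl X) (Equiv.ofBijective _ (endpoint_bijective hgeo))

lemma exists_mem_U (hgeo : IsGeodesicSpace X) (a : Directions o) {r : ℝ} (hr : 0 < r) :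
    ∃ R : ℝ, ∀ b : D.Bordification,
      D.toCompactification hgeo b ∈ N (endpoint hgeo a) R → b ∈ D.U a r := by
  obtain ⟨δ, hδ⟩ := exists_isHyperbolicConst X
  have hδ0 := hδ.1
  obtain ⟨ω, hω, hlim⟩ := exists_geodesic_asymptotic hgeo (endpoint hgeo a)
  have hdir : ω.direction = a := (endpoint_bijective hgeo).1 hlim
  obtain ⟨R, hR⟩ := exists_redirectsAt_of_le_gromovProduct hgeo hω hr
  refine ⟨R + 2 * δ, fun b hb c β hβb hβ => ?_⟩
  rw [← hlim] at hb
  let c₁ : QConst := ⟨c.q + 1, c.q + c.Q, by linarith [c.one_le],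
    by linarith [c.one_le, c.nonneg]⟩
  have hc₁ : RedirectsAt o c₁ r β.1 ω.1 := by
    refine hR c c₁ rfl rfl β.1 hβ ?_
    rcases b with x | b
    · obtain ⟨t, rfl⟩ : x ∈ range β.1 := hβb
      change GromovCompactification.ofPoint (β.1 t) ∈ _ at hb
      obtain ⟨T, hT⟩ := exists_of_ofPoint_mem_N hgeo hδ hb
      refine ⟨t, T, ?_⟩
      rw [gromovProduct_comm]
      linarith [hT T le_rfl]
    · obtain rfl : β.direction = b := hβb
      obtain ⟨T, hT⟩ := exists_of_ofBoundary_mem_N hgeo hδ hb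
      refine ⟨T, T, ?_⟩
      rw [gromovProduct_comm]
      linarith [hT T le_rfl T le_rfl]
  have hf := D.le_f_q hgeo a c
  -- The geodesic ray is itself a `c`-ray of the class `a`, so it can be redirected to the central
  -- element with constants `D.f a c`. The `+ 1` in `F` supplies the strict inequality that
  -- `RedirectsAt.trans` needs.
  refine hc₁.trans hβ hω (D.redirects a a le_rfl c ω hdir (hω.of_geodesic c)) ?_ ?_ ?_ ?_
  · exact le_max_of_le_left (add_le_add_left hf 1)
  · exact le_max_right _ _
  · exact lt_max_of_lt_left (lt_add_one _)
  · exact le_max_of_le_left (le_add_of_nonneg_right zero_le_one)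

/-- Through a point within `R` of `o` passes a ray ending at a boundary point other than that of
`a`, with constants depending only on `R`. Redirecting it to `a` at a large radius would make the
Gromov product of the two endpoints too large. -/
lemma exists_norm_lt_of_mem_U (hgeo : IsGeodesicSpace X) [Nontrivial (GromovBoundary o)]
    (a : Directions o) (R : ℝ) :
    ∃ r : ℝ, ∀ r' ≥ r, ∀ x : X, D.ofPoint x ∈ D.U a r' → R < dist o x := by
  obtain ⟨δ, hδ⟩ := exists_isHyperbolicConst X
  obtain ⟨ξ, hξ⟩ := exists_ne (endpoint hgeo a)
  obtain ⟨ω, hω, hlim⟩ := exists_geodesic_asymptotic hgeo ξ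
  rw [← hlim, D.endpoint_eq hgeo, Ne, QRay.limit_seq_eq_iff] at hξ
  obtain ⟨M, hM⟩ := not_forall.1 hξ
  let c : QConst := ⟨1, 3 * max R 0, le_rfl, by positivity⟩
  obtain ⟨C, -, hC⟩ := exists_le_of_redirectsAt hgeo (D.F a c) c
  refine ⟨M + C + δ, fun r hr x hx => ?_⟩
  by_contra hcon
  obtain ⟨β, hβ, hxβ, hev⟩ := exists_isRay_through hgeo hω (c := c) (x := x)
    (by change _ ≤ 3 * max R 0; linarith [le_max_left R 0])
  obtain ⟨T, hT⟩ := hC o r β _ hβ (hx c ⟨β, c, hβ⟩ hxβ hβ)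
  obtain ⟨T', hT'⟩ := hβ.asymptotic_of_eventuallyCoincide hgeo hev (r - C)
  refine hM ⟨max T T', fun s t hs ht => ?_⟩
  have h1 := hT' (max T' (hitTime o r β)) s (le_max_left _ _) ((le_max_right _ _).trans hs)
  have h2 := hT (max T' (hitTime o r β)) (le_max_right _ _) t ((le_max_left _ _).trans ht)
  rw [gromovProduct_comm] at h1
  have := hδ.le_gromovProduct h1 h2
  linarith

lemma exists_mem_N (hgeo : IsGeodesicSpace X) (hends : NoDeadEnds o)
    [Nontrivial (GromovBoundary o)] (a : Directions o) (R : ℝ) :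
    ∃ r : ℝ, 0 < r ∧ ∀ b ∈ D.U a r, D.toCompactification hgeo b ∈ N (endpoint hgeo a) R := by
  obtain ⟨c, hc⟩ := hends
  obtain ⟨C₁, -, hC₁⟩ := exists_norm_sub_le_of_redirectsAt hgeo (D.F a c)
  obtain ⟨C₂, -, hC₂⟩ := exists_le_of_redirectsAt hgeo (D.F a c) c
  obtain ⟨C₃, -, hC₃⟩ := exists_le_of_redirectsAt hgeo (D.F a D.c₀) D.c₀
  obtain ⟨r₀, hr₀⟩ := D.exists_norm_lt_of_mem_U hgeo a (R + C₁)
  obtain ⟨r, h0, h1, h2, h3⟩ : ∃ r : ℝ, 0 < r ∧ r₀ ≤ r ∧ R + C₂ ≤ r ∧ R + C₃ ≤ r :=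
    ⟨max (max 1 r₀) (max (R + C₂) (R + C₃)), by positivity, by simp, by simp, by simp⟩
  refine ⟨r, h0, fun b hb => ?_⟩
  rw [D.endpoint_eq hgeo]
  rcases b with x | b
  · obtain ⟨β, hβ, t, rfl⟩ := hc x
    have hred := hb c ⟨β, c, hβ⟩ ⟨t, rfl⟩ hβ
    change GromovCompactification.ofPoint (β t) ∈ _
    -- Before the exit time the redirected ray still passes through `β t`, and the bound comes from
    -- its norm; afterwards it comes from `r`.
    rcases le_total t (hitTime o r β) with ht | ht
    · obtain ⟨T, hT⟩ := hC₁ o r β _ hred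
      refine ofPoint_mem_N hgeo (T := T) fun u hu => ?_
      rw [gromovProduct_comm]
      linarith [hT t ht u hu, hr₀ r h1 _ hb]
    · obtain ⟨T, hT⟩ := hC₂ o r β _ hβ hred
      refine ofPoint_mem_N hgeo (T := T) fun u hu => ?_
      rw [gromovProduct_comm]
      linarith [hT t ht u hu]
  -- The rays of a class have no common constants, but the central elements do; this makes `r`
  -- independent of `b`.
  · have hβ := D.central_isRay b
    obtain ⟨T, hT⟩ := hC₃ o r _ _ hβ (hb D.c₀ (D.central b) (D.central_mem b) hβ)
    change ofBoundary (endpoint hgeo b) ∈ _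
    rw [D.endpoint_eq hgeo]
    refine ofBoundary_mem_N hgeo (T := max T (hitTime o r (D.central b).1)) fun s hs t ht => ?_
    rw [gromovProduct_comm]
    linarith [hT t ((le_max_right _ _).trans ht) s ((le_max_left _ _).trans hs)]

/-- Both topologies are defined by their open sets, so mutual inclusion of the basic sets `U` and
`N` is enough; it need not be known that these are neighbourhoods. -/
lemma isOpen_preimage_toCompactification (hgeo : IsGeodesicSpace X) (hends : NoDeadEnds o)
    [Nontrivial (GromovBoundary o)] (V : Set (GromovCompactification o)) :
    IsOpen (D.toCompactification hgeo ⁻¹' V) ↔ IsOpen V := by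
  constructor
  · intro h
    refine ⟨fun x hx => ?_, fun ξ hξ => ?_⟩
    · obtain ⟨r, hr, hsub⟩ := D.mem_nbhd_ofPoint.1 (h (D.ofPoint x) hx)
      refine ⟨r, hr, ?_⟩
      rintro _ ⟨y, hy, rfl⟩
      exact hsub (mem_image_of_mem _ hy)
    · obtain ⟨a, rfl⟩ := (endpoint_bijective hgeo).2 ξ
      obtain ⟨r, hr, hsub⟩ := D.mem_nbhd_ofDirection.1 (h (D.ofDirection a) hξ)
      obtain ⟨R, hR⟩ := D.exists_mem_U hgeo a hr
      refine ⟨R, fun p hp => ?_⟩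
      obtain ⟨b, rfl⟩ := (D.toCompactification hgeo).surjective p
      exact hsub (hR b hp)
  · rintro ⟨h1, h2⟩ (x | a) hb
    · obtain ⟨r, hr, hsub⟩ := h1 x hb
      refine D.mem_nbhd_ofPoint.2 ⟨r, hr, ?_⟩
      rintro _ ⟨y, hy, rfl⟩
      exact hsub (mem_image_of_mem _ hy)
    · obtain ⟨R, hR⟩ := h2 (endpoint hgeo a) hb
      obtain ⟨r, hr, hsub⟩ := D.exists_mem_N hgeo hends a R
      exact D.mem_nbhd_ofDirection.2 ⟨r, hr, fun b hb => hR (hsub b hb)⟩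

lemma pure_le_nbhd (hgeo : IsGeodesicSpace X) : pure ≤ D.nbhd := by
  rintro (x | a) V hV
  · obtain ⟨r, hr, hsub⟩ := D.mem_nbhd_ofPoint.1 hV
    exact hsub (mem_image_of_mem _ (Metric.mem_ball_self hr))
  · obtain ⟨r, hr, hsub⟩ := D.mem_nbhd_ofDirection.1 hV
    obtain ⟨R, hR⟩ := D.exists_mem_U hgeo a hr
    refine hsub (hR _ ?_)
    change ofBoundary (endpoint hgeo a) ∈ _
    rw [D.endpoint_eq hgeo]
    obtain ⟨T, hT⟩ := (D.central_isRay a).asymptotic_self hgeo R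
    exact ofBoundary_mem_N hgeo fun s hs t ht => hT s t hs ht

/-- The sets `U(a, r)` do not visibly contain neighbourhoods of their points. Passing to `N` and
back turns this into the four-point condition for Gromov products. -/
lemma eventually_mem_nbhd (hgeo : IsGeodesicSpace X) (hends : NoDeadEnds o)
    [Nontrivial (GromovBoundary o)] (b : D.Bordification) {V : Set D.Bordification}
    (hV : V ∈ D.nbhd b) : ∀ᶠ y in D.nbhd b, V ∈ D.nbhd y := by
  obtain ⟨δ, hδ⟩ := exists_isHyperbolicConst X
  have hδ0 := hδ.1
  rcases b with x | a
  · obtain ⟨r, hr, hsub⟩ := D.mem_nbhd_ofPoint.1 hV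
    refine D.mem_nbhd_ofPoint.2 ⟨r, hr, ?_⟩
    rintro _ ⟨y, hy, rfl⟩
    exact D.mem_nbhd_ofPoint.2 ⟨r - dist y x, sub_pos.2 hy,
      (image_mono (Metric.ball_subset_ball' (by linarith))).trans hsub⟩
  · obtain ⟨r, hr, hsub⟩ := D.mem_nbhd_ofDirection.1 hV
    obtain ⟨R, hR⟩ := D.exists_mem_U hgeo a hr
    rw [D.endpoint_eq hgeo] at hR
    -- The `1` pays for moving within a unit ball around a point of `X`; the `4 * δ` pays for
    -- replacing sequences by rays and for combining the two Gromov products.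
    obtain ⟨r', hr', hr'N⟩ := D.exists_mem_N hgeo hends a (R + 4 * δ + 1)
    rw [D.endpoint_eq hgeo] at hr'N
    refine D.mem_nbhd_ofDirection.2 ⟨r', hr', fun b hb => ?_⟩
    rcases b with x | b
    · obtain ⟨T, hT⟩ := exists_of_ofPoint_mem_N hgeo hδ (hr'N _ hb)
      refine D.mem_nbhd_ofPoint.2 ⟨1, one_pos, ?_⟩
      rintro _ ⟨y, hy, rfl⟩
      refine hsub (hR _ (ofPoint_mem_N hgeo (T := T) fun t ht => ?_))
      change R ≤ gromovProduct o _ y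
      change ∀ t ≥ T, _ ≤ gromovProduct o _ x at hT
      have h1 := gromovProduct_le_add o x y ((D.central a).1 t)
      rw [Metric.mem_ball, dist_comm] at hy
      rw [gromovProduct_comm o x, gromovProduct_comm o y] at h1
      linarith [hT t ht]
    · have hb' := hr'N _ hb
      change ofBoundary (endpoint hgeo b) ∈ _ at hb'
      rw [D.endpoint_eq hgeo] at hb'
      obtain ⟨T, hT⟩ := exists_of_ofBoundary_mem_N hgeo hδ hb'
      obtain ⟨r'', hr'', hr''N⟩ := D.exists_mem_N hgeo hends b (R + 4 * δ + 1)
      rw [D.endpoint_eq hgeo] at hr''N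
      refine D.mem_nbhd_ofDirection.2 ⟨r'', hr'', fun p hp => hsub (hR _ ?_)⟩
      have hpN := hr''N p hp
      rcases p with x | p
      · obtain ⟨T', hT'⟩ := exists_of_ofPoint_mem_N hgeo hδ hpN
        refine ofPoint_mem_N hgeo (T := T) fun t ht => ?_
        have := hδ.le_gromovProduct (K := R + δ)
          ((hT t ht (max T T') (le_max_left _ _)).trans' (by linarith))
          ((hT' (max T T') (le_max_right _ _)).trans' (by linarith))
        linarith
      · change ofBoundary (endpoint hgeo p) ∈ _ at hpN
        change ofBoundary (endpoint hgeo p) ∈ _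
        rw [D.endpoint_eq hgeo p] at hpN ⊢
        obtain ⟨T', hT'⟩ := exists_of_ofBoundary_mem_N hgeo hδ hpN
        refine ofBoundary_mem_N hgeo (T := max T T') fun s hs t ht => ?_
        have := hδ.le_gromovProduct (K := R + δ)
          ((hT s ((le_max_left _ _).trans hs) (max T T') (le_max_left _ _)).trans' (by linarith))
          ((hT' (max T T') (le_max_right _ _) t ((le_max_right _ _).trans ht)).trans'
            (by linarith))
        linarith

lemma nhds_eq_nbhd (hgeo : IsGeodesicSpace X) (hends : NoDeadEnds o)
    [Nontrivial (GromovBoundary o)] (b : D.Bordification) : 𝓝 b = D.nbhd b :=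
  -- The topology of `D.Bordification` is `TopologicalSpace.mkOfNhds D.nbhd` by definition.
  TopologicalSpace.nhds_mkOfNhds D.nbhd b (D.pure_le_nbhd hgeo)
    fun b _ hV => D.eventually_mem_nbhd hgeo hends b hV

end RedirectingData

end Bordification

end QuasiRedirecting

theorem mainTheorem11 {X : Type*} [MetricSpace X] [ProperSpace X]
    [QuasiRedirecting.GromovHyperbolic X] (hgeo : QuasiRedirecting.IsGeodesicSpace X) (o : X)
    (hends : QuasiRedirecting.NoDeadEnds o)
    (hbdry : Nontrivial (QuasiRedirecting.GromovBoundary o)) :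
    Nonempty (QuasiRedirecting.RedirectingData o) ∧
    ∀ D : QuasiRedirecting.RedirectingData o,
      (∀ b : D.Bordification, 𝓝 b = D.nbhd b) ∧
      ∃ Φ : D.Bordification ≃ₜ QuasiRedirecting.GromovCompactification o,
        (∀ x : X, Φ (D.ofPoint x) = QuasiRedirecting.GromovCompactification.ofPoint x) ∧
        ∀ α : QuasiRedirecting.QRay o, ∃ s : QuasiRedirecting.GromovSeq o,
          (∀ n : ℕ, s.1 n = α.1 n) ∧
          Φ (D.ofDirection α.direction) =
            QuasiRedirecting.GromovCompactification.ofBoundary s.limit :=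
  ⟨QuasiRedirecting.nonempty_redirectingData hgeo, fun D => ⟨D.nhds_eq_nbhd hgeo hends,
    (D.toCompactification hgeo).toHomeomorph
      (D.isOpen_preimage_toCompactification hgeo hends),
    fun _ => rfl, fun α => ⟨α.seq hgeo, fun _ => rfl, rfl⟩⟩⟩
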